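/- Let $F(x)=e^{-|x|}$ for $|x|<1$ (extended by continuity to $|x|\le 1$), and let $\mathscr H_F$ be the reproducing kernel Hilbert space of the kernel $(x,y)\mapsto F(x-y)$ on $(0,1)$; its elements are continuous functions and are regarded as functions on $[0,1]$. Inner products are linear in the second variable. For $x\in[0,1]$ write $F_x=F(\cdot-x)\in\mathscr H_F$, so that $\langle F_x,\xi\rangle=\xi(x)$; in particular $F_0=e^{-x}$ and $F_1=e^{x-1}$. For $\varphi\in C_c^\infty(0,1)$ let $F_\varphi=\int_0^1\varphi(y)F(\cdot-y)\,dy\in\mathscr H_F$, let $D_F$ be the operator in $\mathscr H_F$ with domain $\{F_\varphi:\varphi\in C_c^\infty(0,1)\}$ and $D_F F_\varphi=F_{\varphi'}$, and let $\overline{D_F}$ be its closure. For $\theta\in\mathbb R$ let $A_\theta$ be the operator with domain $\{h+c(F_0+e^{i\theta}F_1): h\in \mathrm{dom}(\overline{D_F}),\ c\in\mathbb C\}$ and $$A_\theta\bigl(h+c(F_0+e^{i\theta}F_1)\bigr)=-i\,\overline{D_F}h+i\,c\,(F_0-e^{i\theta}F_1).$$ Then $A_\theta$ is a selfadjoint extension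 of $-iD_F$, and its spectrum $\Lambda_\theta$ is a discrete subset of $\mathbb R$ (finite in every bounded interval). Moreover $\sum_{\lambda\in\Lambda_\theta}\frac{2}{\lambda^2+3}<\infty$, and the function $$\widetilde F_\theta(x)=\sum_{\lambda\in\Lambda_\theta}\frac{2}{\lambda^2+3}\,e^{i\lambda x},\qquad x\in\mathbb R,$$ is a continuous positive definite function on $\mathbb R$ with $\widetilde F_\theta(x)=e^{-|x|}$ for $|x|<1$. It is a type 1 extension of $F$: there is a strongly continuous unitary representation $U$ of $\mathbb R$ on $\mathscr H_F$ itself such that $U(-x)F_0=F_x$ for $x\in[0,1]$ and $\widetilde F_\theta(t)=\langle F_0,U(t)F_0\rangle$ for all $t\in\mathbb R$. Its spectral measure is $$\mu_\theta=\sum_{\lambda\in\Lambda_\theta}\frac{2}{\lambda^2+3}\,\delta_\lambda ,$$ that is, $\mu_\theta$ is a probability measure, and it is the unique finite Borel measure on $\mathbb R$ with $\widetilde F_\theta(x)=\int_{\mathbb R}e^{i\lambda x}\,d\mu_\theta(\lambda)$ for all $x\in\mathbb R$. -/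

import Mathlib

open MeasureTheory Set Filter Topology
open scoped ContDiff ComplexConjugate

noncomputable section

namespace ExpExt

/-- The function `F(x) = e^{-|x|}`; only its values on `[-1, 1]` (the closure of `(-1, 1)`) enter the
construction of the Hilbert space below. -/
def F (x : ℝ) : ℂ := (Real.exp (-|x|) : ℂ)

/-- The kernel `(x, y) ↦ F(x - y)` on `[0, 1]`, with values viewed as operators on `ℂ`. -/
def kernelF : Matrix unitInterval unitInterval (ℂ →L[ℂ] ℂ) :=
  Matrix.of fun x y => F ((x : ℝ) - (y : ℝ)) • ContinuousLinearMap.id ℂ ℂ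

/-- Auxiliary vectors in `L²(ℝ)` whose Gram matrix is `F(x - y)`. -/
def gramVec (x : unitInterval) : Lp ℂ 2 (volume : Measure ℝ) :=
  (Real.exp (-(x : ℝ)) : ℂ) •
    indicatorConstLp 2 (measurableSet_Ioc (a := (0 : ℝ)) (b := Real.exp (2 * (x : ℝ))))
      (by simp) (1 : ℂ)

theorem inner_gramVec (x y : unitInterval) :
    inner ℂ (gramVec x) (gramVec y) = F ((x : ℝ) - (y : ℝ)) := by
  have key : (volume : Measure ℝ).real
      (Ioc 0 (Real.exp (2 * (x : ℝ))) ∩ Ioc 0 (Real.exp (2 * (y : ℝ))))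
      = Real.exp (2 * min (x : ℝ) (y : ℝ)) := by
    rw [Ioc_inter_Ioc, max_self, Real.volume_real_Ioc_of_le]
    · rcases le_total (x : ℝ) (y : ℝ) with h | h
      · rw [min_eq_left h, min_eq_left (Real.exp_le_exp.2 (by linarith)), sub_zero]
      · rw [min_eq_right h, min_eq_right (Real.exp_le_exp.2 (by linarith)), sub_zero]
    · positivity
  unfold gramVec F
  rw [inner_smul_left, inner_smul_right,
    L2.inner_indicatorConstLp_one_indicatorConstLp_one (𝕜 := ℂ) (hμs := by simp) (hμt := by simp),
    key, Complex.conj_ofReal]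
  change (_ : ℂ) * (_ * ((Real.exp _ : ℝ) : ℂ)) = _
  rw [← Complex.ofReal_mul, ← Complex.ofReal_mul, ← Real.exp_add, ← Real.exp_add]
  congr 2
  rcases le_total (x : ℝ) (y : ℝ) with h | h
  · rw [min_eq_left h, abs_of_nonpos (by linarith)]; ring
  · rw [min_eq_right h, abs_of_nonneg (by linarith)]; ring

theorem posSemidef_kernelF : kernelF.PosSemidef := by
  have htfae := (RKHS.posSemidef_tfae (K := kernelF)).out 0 2
  refine htfae.2 ⟨?_, fun v => ?_⟩
  · ext x y
    have hid : star (ContinuousLinearMap.id ℂ ℂ) = ContinuousLinearMap.id ℂ ℂ :=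
      star_one (ℂ →L[ℂ] ℂ)
    simp [kernelF, F, abs_sub_comm, hid, ← Complex.exp_conj]
  · have h : (v.sum fun x w => v.sum fun x' w' => inner ℂ (kernelF x' x w) w')
        = inner ℂ (v.sum fun x w => w • gramVec x) (v.sum fun x w => w • gramVec x) := by
      rw [Finsupp.sum_inner]
      refine Finsupp.sum_congr fun x _ => ?_
      rw [Finsupp.inner_sum]
      simp only [inner_smul_left]
      refine Finsupp.sum_congr fun y _ => ?_
      rw [inner_smul_right, inner_gramVec]
      simp [kernelF, F, abs_sub_comm, ← Complex.exp_conj]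
      ring
    rw [h]
    exact inner_self_nonneg

instance : Fact kernelF.PosSemidef := ⟨posSemidef_kernelF⟩

/-- The reproducing kernel Hilbert space `H_F`, a Hilbert space of functions on `[0, 1]`. -/
abbrev HF : Type := RKHS.OfKernel kernelF

/-- The kernel vector `F_x = F(· - x)`, for which `⟪F_x, ξ⟫ = ξ(x)`. -/
def kvec (x : unitInterval) : HF := RKHS.kerFun HF x 1

theorem kvec_apply (x y : unitInterval) : (kvec x : HF) y = F ((y : ℝ) - (x : ℝ)) := by
  rw [kvec, RKHS.kerFun_apply, RKHS.OfKernel.kernel_ofKernel]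
  simp [kernelF]

theorem inner_kvec (x : unitInterval) (f : HF) : inner ℂ (kvec x) f = f x := by
  simp [kvec]

/-- `φ ∈ C_c^∞(0, 1)`. -/
def IsTest (φ : ℝ → ℂ) : Prop :=
  ContDiff ℝ ∞ φ ∧ HasCompactSupport φ ∧ tsupport φ ⊆ Ioo 0 1

/-- `F_φ = ∫₀¹ φ(y) F(· - y) dy` as an element of `H_F`. -/
def smear (φ : ℝ → ℂ) : HF := ∫ y : unitInterval, φ y • kvec y

theorem norm_kvec (x : unitInterval) : ‖kvec x‖ = 1 := by
  have h := inner_self_eq_norm_sq_to_K (𝕜 := ℂ) (kvec x)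
  rw [inner_kvec, kvec_apply] at h
  simp [F] at h
  have h2 : ‖kvec x‖ ^ 2 = 1 := by exact_mod_cast h.symm
  nlinarith [norm_nonneg (kvec x)]

theorem continuous_kvec : Continuous kvec := by
  rw [continuous_iff_continuousAt]
  intro x
  rw [ContinuousAt, tendsto_iff_norm_sub_tendsto_zero]
  have hn : ∀ y, ‖kvec y - kvec x‖ = √(2 * (1 - Real.exp (-|(y : ℝ) - (x : ℝ)|))) := by
    intro y
    rw [← Real.sqrt_sq (norm_nonneg (kvec y - kvec x)), norm_sub_sq (𝕜 := ℂ), norm_kvec, norm_kvec,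
      inner_kvec, kvec_apply, F, RCLike.re_eq_complex_re, Complex.ofReal_re]
    congr 1
    ring
  simp_rw [hn]
  have : Continuous fun y : unitInterval => √(2 * (1 - Real.exp (-|(y : ℝ) - (x : ℝ)|))) := by
    fun_prop
  simpa using this.tendsto x

theorem integrable_smear {φ : ℝ → ℂ} (hφ : Continuous φ) :
    Integrable fun y : unitInterval => φ y • kvec y :=
  Continuous.integrable_of_hasCompactSupport
    ((hφ.comp continuous_subtype_val).smul continuous_kvec)
    (HasCompactSupport.of_compactSpace _)

theorem smear_apply {φ : ℝ → ℂ} (hφ : Continuous φ) (x : unitInterval) :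
    smear φ x = ∫ y in (0 : ℝ)..1, φ y * F ((x : ℝ) - y) := by
  rw [← inner_kvec, smear, ← integral_inner (integrable_smear hφ)]
  simp_rw [inner_smul_right, inner_kvec, kvec_apply]
  rw [intervalIntegral.integral_of_le zero_le_one, ← integral_Icc_eq_integral_Ioc]
  exact integral_subtype (s := unitInterval) measurableSet_Icc
    (fun y : ℝ => φ y * F ((x : ℝ) - y))

theorem IsTest.add {φ ψ : ℝ → ℂ} (hφ : IsTest φ) (hψ : IsTest ψ) : IsTest (φ + ψ) :=
  ⟨hφ.1.add hψ.1, hφ.2.1.add hψ.2.1,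
    (tsupport_add φ ψ).trans (union_subset hφ.2.2 hψ.2.2)⟩

theorem IsTest.smul {φ : ℝ → ℂ} (c : ℂ) (hφ : IsTest φ) : IsTest (c • φ) :=
  ⟨hφ.1.const_smul c, hφ.2.1.smul_left (f := fun _ => c),
    (tsupport_smul_subset_right (fun _ => c) φ).trans hφ.2.2⟩

theorem IsTest.deriv {φ : ℝ → ℂ} (hφ : IsTest φ) : IsTest (deriv φ) :=
  ⟨(contDiff_infty_iff_deriv.1 hφ.1).2, hφ.2.1.deriv,
    (tsupport_deriv_subset).trans hφ.2.2⟩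

theorem smear_add {φ ψ : ℝ → ℂ} (hφ : Continuous φ) (hψ : Continuous ψ) :
    smear (φ + ψ) = smear φ + smear ψ := by
  simp only [smear, Pi.add_apply, add_smul]
  exact integral_add (integrable_smear hφ) (integrable_smear hψ)

theorem smear_smul (c : ℂ) (φ : ℝ → ℂ) : smear (c • φ) = c • smear φ := by
  simp only [smear, Pi.smul_apply, smul_assoc]
  exact integral_smul c _

/-- The graph `{(F_φ, F_{φ'}) | φ ∈ C_c^∞(0, 1)}`. -/
def graphD : Submodule ℂ (HF × HF) where
  carrier := {p | ∃ φ, IsTest φ ∧ p = (smear φ, smear (deriv φ))}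
  zero_mem' := ⟨0, ⟨contDiff_const, HasCompactSupport.zero, by simp [tsupport]⟩, by
    have h0 : deriv (0 : ℝ → ℂ) = 0 := by ext; simp
    have h1 : smear 0 = 0 := by simp [smear]
    rw [h0, h1]; rfl⟩
  add_mem' := by
    rintro _ _ ⟨φ, hφ, rfl⟩ ⟨ψ, hψ, rfl⟩
    refine ⟨φ + ψ, hφ.add hψ, ?_⟩
    have hd : deriv (φ + ψ) = deriv φ + deriv ψ := by
      ext x
      exact deriv_add (hφ.1.differentiable (by simp)).differentiableAt
        (hψ.1.differentiable (by simp)).differentiableAt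
    rw [hd, smear_add hφ.1.continuous hψ.1.continuous,
      smear_add hφ.deriv.1.continuous hψ.deriv.1.continuous]
    rfl
  smul_mem' := by
    rintro c _ ⟨φ, hφ, rfl⟩
    refine ⟨c • φ, hφ.smul c, ?_⟩
    have hd : deriv (c • φ) = c • deriv φ := by
      ext x
      exact deriv_const_smul c (hφ.1.differentiable (by simp)).differentiableAt
    rw [hd, smear_smul, smear_smul]
    rfl

/-- The operator `D_F`, with domain `{F_φ | φ ∈ C_c^∞(0, 1)}` and `D_F F_φ = F_{φ'}`. -/
def opD : HF →ₗ.[ℂ] HF := graphD.toLinearPMap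

/-- The symmetric operator `-i D_F`. -/
def opS : HF →ₗ.[ℂ] HF := (-Complex.I) • opD

/-- The graph of `A_θ`: all pairs
`(h + c (e^{-x} + e^{iθ} e^{x-1}), -i h' + i c (e^{-x} - e^{iθ} e^{x-1}))`, with `c ∈ ℂ` and `h` in the
domain of the closure of `D_F`. Here `kvec 0 = e^{-x}` and `kvec 1 = e^{x-1}`. -/
def graphA (θ : ℝ) : Submodule ℂ (HF × HF) :=
  opS.graph.topologicalClosure ⊔
    Submodule.span ℂ {(kvec 0 + Complex.exp (Complex.I * θ) • kvec 1,
      Complex.I • (kvec 0 - Complex.exp (Complex.I * θ) • kvec 1))}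

/-- The selfadjoint extension `A_θ` of `-i D_F`. -/
def opA (θ : ℝ) : HF →ₗ.[ℂ] HF := (graphA θ).toLinearPMap

/-- Extension of a function in `H_F` to `ℝ`, constant outside `[0, 1]`. -/
def evalR (g : HF) (t : ℝ) : ℂ := g (projIcc 0 1 zero_le_one t)

theorem continuous_evalR (g : HF) : Continuous (evalR g) := by
  have : evalR g = fun t => inner ℂ (kvec (projIcc 0 1 zero_le_one t)) g := by
    ext t; rw [inner_kvec]; rfl
  rw [this]
  exact (continuous_kvec.comp continuous_projIcc).inner continuous_const

theorem norm_evalR_le (g : HF) (t : ℝ) : ‖evalR g t‖ ≤ ‖g‖ := by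
  rw [evalR, ← inner_kvec]
  simpa [norm_kvec] using norm_inner_le_norm (𝕜 := ℂ) (kvec (projIcc 0 1 zero_le_one t)) g

/-- Pairs `(f, g)` with `-i f' = g`, in integrated form. -/
def primRel : Submodule ℂ (HF × HF) where
  carrier := {p | ∀ x : unitInterval,
    p.1 x = p.1 0 + Complex.I * ∫ t in (0 : ℝ)..x, evalR p.2 t}
  zero_mem' := by intro x; simp [evalR]
  add_mem' := by
    intro p q hp hq x
    have : evalR (p + q).2 = fun t => evalR p.2 t + evalR q.2 t := by
      ext t; simp [evalR]
    rw [this, intervalIntegral.integral_add ((continuous_evalR _).intervalIntegrable _ _)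
      ((continuous_evalR _).intervalIntegrable _ _)]
    simp only [Prod.fst_add, RKHS.coe_add, Pi.add_apply]
    rw [hp x, hq x]
    ring
  smul_mem' := by
    intro c p hp x
    have : evalR (c • p).2 = fun t => c * evalR p.2 t := by
      ext t; simp [evalR]
    rw [this, intervalIntegral.integral_const_mul]
    simp only [Prod.smul_fst, RKHS.coe_smul, Pi.smul_apply, smul_eq_mul]
    rw [hp x]
    ring

theorem isClosed_primRel : IsClosed (primRel : Set (HF × HF)) := by
  have : (primRel : Set (HF × HF)) = ⋂ x : unitInterval, {p | p.1 x = p.1 0 +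
      Complex.I * ∫ t in (0 : ℝ)..x, evalR p.2 t} := by
    ext p; simp [primRel]
  rw [this]
  refine isClosed_iInter fun x => isClosed_eq
    ((RKHS.continuous_eval x).comp continuous_fst)
    (((RKHS.continuous_eval 0).comp continuous_fst).add (continuous_const.mul ?_))
  have hlip : LipschitzWith 1 fun g : HF => ∫ t in (0 : ℝ)..x, evalR g t := by
    refine LipschitzWith.of_dist_le_mul fun g h => ?_
    rw [dist_eq_norm, dist_eq_norm, ← intervalIntegral.integral_sub
      ((continuous_evalR _).intervalIntegrable _ _) ((continuous_evalR _).intervalIntegrable _ _)]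
    have hx0 := x.2.1
    have hx1 := x.2.2
    refine (intervalIntegral.norm_integral_le_of_norm_le_const (C := ‖g - h‖) fun t _ => ?_).trans ?_
    · have : evalR g t - evalR h t = evalR (g - h) t := by simp [evalR]
      rw [this]
      exact norm_evalR_le _ _
    · rw [sub_zero, abs_of_nonneg hx0, NNReal.coe_one, one_mul]
      exact mul_le_of_le_one_right (norm_nonneg _) hx1
  exact hlip.continuous.comp continuous_snd

theorem primRel_functional (p : HF × HF) (hp : p ∈ primRel) (h0 : p.1 = 0) : p.2 = 0 := by
  have hint : ∀ x ∈ Icc (0 : ℝ) 1, ∫ t in (0 : ℝ)..x, evalR p.2 t = 0 := by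
    intro x hx
    have := hp ⟨x, hx⟩
    simpa [h0] using this
  have hin : ∀ x ∈ Ioo (0 : ℝ) 1, evalR p.2 x = 0 := by
    intro x hx
    have h1 := (continuous_evalR p.2).integral_hasStrictDerivAt 0 x
    have h2 : HasDerivAt (fun u => ∫ t in (0 : ℝ)..u, evalR p.2 t) 0 x :=
      (hasDerivAt_const x (0 : ℂ)).congr_of_eventuallyEq
        (Filter.eventually_of_mem (Icc_mem_nhds hx.1 hx.2) hint)
    exact h1.hasDerivAt.unique h2
  have hcl : ∀ x ∈ Icc (0 : ℝ) 1, evalR p.2 x = 0 := by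
    have hc : IsClosed {x | evalR p.2 x = 0} :=
      isClosed_eq (continuous_evalR _) continuous_const
    have := closure_minimal (s := Ioo (0 : ℝ) 1) (fun x hx => hin x hx) hc
    rwa [closure_Ioo zero_ne_one] at this
  refine RKHS.ext fun x => ?_
  simpa [evalR] using hcl x x.2

theorem hasDerivAt_smear {φ : ℝ → ℂ} (hφ : IsTest φ) (x : ℝ) :
    HasDerivAt (fun x : ℝ => ∫ y in (0 : ℝ)..1, φ y * F (x - y))
      (∫ y in (0 : ℝ)..1, deriv φ y * F (x - y)) x := by
  have hF : Continuous F := by unfold F; fun_prop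
  have hconv : ∀ ψ : ℝ → ℂ, IsTest ψ → ∀ x : ℝ,
      (convolution ψ F (ContinuousLinearMap.mul ℝ ℂ) volume) x
        = ∫ y in (0 : ℝ)..1, ψ y * F (x - y) := by
    intro ψ hψ x
    rw [intervalIntegral.integral_of_le zero_le_one, convolution_def]
    refine (setIntegral_eq_integral_of_forall_compl_eq_zero fun y hy => ?_).symm
    have : y ∉ tsupport ψ := fun h => hy (Ioo_subset_Ioc_self (hψ.2.2 h))
    simp [image_eq_zero_of_notMem_tsupport this]
  have h := hφ.2.1.hasDerivAt_convolution_left (ContinuousLinearMap.mul ℝ ℂ) (μ := volume)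
    (hφ.1.of_le (by simp)) hF.locallyIntegrable x
  rw [hconv _ hφ.deriv] at h
  exact h.congr_of_eventuallyEq (Filter.Eventually.of_forall fun y => (hconv φ hφ y).symm)

theorem smear_mem_primRel {φ : ℝ → ℂ} (hφ : IsTest φ) :
    (smear φ, (-Complex.I) • smear (deriv φ)) ∈ primRel := by
  intro x
  have hx0 := x.2.1
  have hx1 := x.2.2
  have hev : ∀ t ∈ uIcc (0 : ℝ) x, evalR ((-Complex.I) • smear (deriv φ)) t
      = -Complex.I * ∫ y in (0 : ℝ)..1, deriv φ y * F (t - y) := by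
    intro t ht
    rw [uIcc_of_le hx0] at ht
    have ht' : t ∈ Icc (0 : ℝ) 1 := ⟨ht.1, ht.2.trans hx1⟩
    rw [evalR, projIcc_of_mem _ ht', RKHS.coe_smul, Pi.smul_apply, smul_eq_mul,
      smear_apply hφ.deriv.1.continuous]
  have hc : Continuous fun t : ℝ => ∫ y in (0 : ℝ)..1, deriv φ y * F (t - y) :=
    continuous_iff_continuousAt.2 fun t => (hasDerivAt_smear hφ.deriv t).continuousAt
  simp only
  rw [intervalIntegral.integral_congr hev, intervalIntegral.integral_const_mul,
    intervalIntegral.integral_eq_sub_of_hasDerivAt (fun t _ => hasDerivAt_smear hφ t)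
      (hc.intervalIntegrable _ _), smear_apply hφ.1.continuous, smear_apply hφ.1.continuous]
  rw [← mul_assoc, mul_neg, Complex.I_mul_I]
  simp

/-- `F_φ ↦ F_{φ'}` is well defined. -/
theorem graphD_functional (p : HF × HF) (hp : p ∈ graphD) (h0 : p.1 = 0) : p.2 = 0 := by
  obtain ⟨φ, hφ, rfl⟩ := hp
  have := primRel_functional _ (smear_mem_primRel hφ) h0
  simpa using this

theorem opD_graph : opD.graph = graphD :=
  Submodule.toLinearPMap_graph_eq _ graphD_functional

theorem kvec_mem_primRel (c : ℂ) :
    (kvec 0 + c • kvec 1, Complex.I • (kvec 0 - c • kvec 1)) ∈ primRel := by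
  intro x
  have hx0 := x.2.1
  have hx1 := x.2.2
  have hval : ∀ t : unitInterval, (kvec 0) t = (Real.exp (-(t : ℝ)) : ℂ) ∧
      (kvec 1) t = (Real.exp ((t : ℝ) - 1) : ℂ) := by
    intro t
    have h0 := t.2.1
    have h1 := t.2.2
    constructor
    · rw [kvec_apply, F]
      simp [abs_of_nonneg h0]
    · rw [kvec_apply, F, Icc.coe_one, abs_of_nonpos (by linarith), neg_neg]
  have hev : ∀ t ∈ uIcc (0 : ℝ) x, evalR (Complex.I • (kvec 0 - c • kvec 1)) t
      = Complex.I * ((Real.exp (-t) : ℂ) - c * (Real.exp (t - 1) : ℂ)) := by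
    intro t ht
    rw [uIcc_of_le hx0] at ht
    have ht' : t ∈ Icc (0 : ℝ) 1 := ⟨ht.1, ht.2.trans hx1⟩
    rw [evalR, projIcc_of_mem _ ht']
    simp [hval]
  have hder : ∀ t ∈ uIcc (0 : ℝ) x,
      HasDerivAt (fun t : ℝ => -(Real.exp (-t) : ℂ) - c * (Real.exp (t - 1) : ℂ))
        ((Real.exp (-t) : ℂ) - c * (Real.exp (t - 1) : ℂ)) t := by
    intro t _
    have h1 : HasDerivAt (fun t : ℝ => (Real.exp (-t) : ℂ)) (-Real.exp (-t) : ℝ) t := by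
      have := ((hasDerivAt_neg t).exp).ofReal_comp
      simpa using this
    have h2 : HasDerivAt (fun t : ℝ => (Real.exp (t - 1) : ℂ)) (Real.exp (t - 1) : ℝ) t := by
      have := (((hasDerivAt_id t).sub_const 1).exp).ofReal_comp
      simpa using this
    have h3 := h1.fun_neg.fun_sub (h2.const_mul c)
    simpa only [Complex.ofReal_neg, neg_neg] using h3
  simp only
  rw [intervalIntegral.integral_congr hev, intervalIntegral.integral_const_mul,
    intervalIntegral.integral_eq_sub_of_hasDerivAt hder
      (Continuous.intervalIntegrable (by fun_prop) _ _)]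
  rw [← mul_assoc, Complex.I_mul_I]
  simp only [RKHS.coe_add, RKHS.coe_smul, Pi.add_apply, Pi.smul_apply, smul_eq_mul, hval,
    Icc.coe_zero]
  ring

theorem graphA_le_primRel (θ : ℝ) : graphA θ ≤ primRel := by
  refine sup_le (Submodule.topologicalClosure_minimal _ ?_ isClosed_primRel) ?_
  · intro p hp
    obtain ⟨⟨a, ha⟩, h1, h2⟩ := (LinearPMap.mem_graph_iff _).1 hp
    have hmem : (a, opD ⟨a, ha⟩) ∈ graphD := opD_graph ▸ LinearPMap.mem_graph opD ⟨a, ha⟩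
    obtain ⟨φ, hφ, he⟩ := hmem
    have hp' : p = (smear φ, (-Complex.I) • smear (deriv φ)) := by
      refine Prod.ext (h1.symm.trans (congrArg Prod.fst he)) (h2.symm.trans ?_)
      exact congrArg (fun z => (-Complex.I) • z) (congrArg Prod.snd he)
    rw [hp']
    exact smear_mem_primRel hφ
  · rw [Submodule.span_singleton_le_iff_mem]
    exact kvec_mem_primRel _

/-- The subspace `graphA θ` is the graph of an operator. -/
theorem opA_graph (θ : ℝ) : (opA θ).graph = graphA θ :=
  Submodule.toLinearPMap_graph_eq _ fun p hp h0 =>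
    primRel_functional p (graphA_le_primRel θ hp) h0

/-- The resolvent set of a possibly unbounded operator: `A - z` is a bijection of the domain onto the
space, with bounded inverse. -/
def resolventSetOp {H : Type*} [NormedAddCommGroup H] [NormedSpace ℂ H]
    (A : H →ₗ.[ℂ] H) : Set ℂ :=
  {z | Function.Bijective (fun f : A.domain => A f - z • (f : H)) ∧
    ∃ C : ℝ, ∀ f : A.domain, ‖(f : H)‖ ≤ C * ‖A f - z • (f : H)‖}

/-- The spectrum of a possibly unbounded operator. -/
def spectrumOp {H : Type*} [NormedAddCommGroup H] [NormedSpace ℂ H]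
    (A : H →ₗ.[ℂ] H) : Set ℂ :=
  (resolventSetOp A)ᶜ

/-- The spectrum `Λ_θ` of `A_θ`, as a set of real numbers. -/
def Lam (θ : ℝ) : Set ℝ := {l | (l : ℂ) ∈ spectrumOp (opA θ)}

/-- `F̃_θ(x) = ∑_{λ ∈ Λ_θ} 2 / (λ² + 3) e^{iλx}`. -/
def Fext (θ : ℝ) (x : ℝ) : ℂ :=
  ∑' l : Lam θ, ((2 / ((l : ℝ) ^ 2 + 3) : ℝ) : ℂ) * Complex.exp (Complex.I * (l : ℝ) * x)

/-- `μ_θ = ∑_{λ ∈ Λ_θ} 2 / (λ² + 3) δ_λ`. -/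
def muExt (θ : ℝ) : Measure ℝ :=
  Measure.sum fun l : Lam θ => ENNReal.ofReal (2 / ((l : ℝ) ^ 2 + 3)) • Measure.dirac (l : ℝ)

open scoped ComplexOrder in
/-- Positive definite functions on `ℝ` (the order on `ℂ` says: real and nonnegative). -/
def IsPosDefFun (G : ℝ → ℂ) : Prop :=
  ∀ (n : ℕ) (c : Fin n → ℂ) (x : Fin n → ℝ),
    0 ≤ ∑ i, ∑ j, conj (c i) * c j * G (x i - x j)

/-- `U` is a strongly continuous unitary representation of `ℝ`. -/
def IsUnitaryRep {H : Type*} [NormedAddCommGroup H] [InnerProductSpace ℂ H]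
    (U : ℝ → H ≃ₗᵢ[ℂ] H) : Prop :=
  (∀ s t ξ, U (s + t) ξ = U s (U t ξ)) ∧ ∀ ξ, Continuous fun t => U t ξ

/-- `G` is a type 1 extension of `F`: it is a matrix coefficient `⟪F_0, U(t) F_0⟫` of a strongly
continuous unitary representation `U` of `ℝ` acting in `H_F` itself, `H_F` being situated in the
representation space in the natural way, `U(-x) F_0 = F_x`. (In general a dilation of `F` with cyclic
vector `k_0` contains `H_F` isometrically through `F_x ↦ U(-x) k_0`.) -/
def IsTypeOne (G : ℝ → ℂ) : Prop :=
  ∃ U : ℝ → HF ≃ₗᵢ[ℂ] HF, IsUnitaryRep U ∧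
    (∀ x : unitInterval, U (-(x : ℝ)) (kvec 0) = kvec x) ∧
    ∀ t : ℝ, G t = inner ℂ (kvec 0) (U t (kvec 0))

end ExpExt

end

noncomputable section

namespace ExpExt

/-! The adjoint of `-i D_F` is the maximal relation `-i d/dx` (`adjoint_graph_opS`). Its
eigenvectors at `i` and `-i` are multiples of the kernel vectors `e^{-x}` and `e^{x-1}`, so the
deficiency indices are (1, 1). Since kernel vectors act by evaluation, the form that tests
membership in the adjoint of `graphA θ` involves only endpoint values. Hence `A_θ` is `-i d/dx`
under one boundary condition, and selfadjointness is a computation (`adjoint_graphA`,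
`mem_graphA_iff`).

The exponential `e^{ilx}` satisfies this condition exactly when `secular θ l = 0`. Its squared norm
in `H_F` is `(l² + 3)/2`, which is the origin of the weights `2/(l² + 3)`. Zeros of `secular θ` are
real and simple.

The crux is completeness of the eigenfunctions (`eq_zero_of_inner_expVec_eq_zero`), proved without
compactness of the resolvent. If `f` is orthogonal to all of them, then `u_z = (A_θ - z)⁻¹ f`, given
by variation of constants, has `u_z(0) = -numer/secular`, and the numerator vanishes at each simple
zero of the denominator. So `z ↦ u_z(x)` continues to an entire function. Selfadjointness bounds it
by `‖f‖/|Im z|`, so it is zero, and then `f = 0`.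

In the resulting orthonormal eigenbasis `A_θ` is diagonal, which yields its spectrum, and the
diagonal group `e^{ilt}` is the required representation: the coefficients of `F_x` are those of
`F_0` times `e^{-ilx}`, hence `U(-x) F_0 = F_x`. Parseval for `F_0` gives total mass 1, the matrix
coefficient of `F_0` is the series, and uniqueness of the measure is injectivity of characteristic
functions. -/

/-! ### A Liouville-type theorem and test functions on the unit interval -/

/-- An entire function bounded by `C / |Im z|` vanishes. -/
theorem eq_zero_of_norm_mul_abs_im_le {G : ℂ → ℂ} (hG : Differentiable ℂ G) {C : ℝ}
    (h : ∀ z : ℂ, z.im ≠ 0 → ‖G z‖ * |z.im| ≤ C) (z : ℂ) : G z = 0 := by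
  have hC : 0 ≤ C := le_trans (by positivity) (h Complex.I (by simp))
  have key : ∀ R : ℝ, ‖z‖ < R → ‖G z‖ * (R ^ 2 - ‖z‖ ^ 2) ≤ 2 * R * C := by
    intro R hR
    have hR0 : 0 < R := (norm_nonneg z).trans_lt hR
    -- On `|w| = R` the factor `w² - R²` has modulus `2R|Im w|`, which absorbs the singularity of
    -- the bound at the real axis. The maximum principle then gives `key`.
    have hd : Differentiable ℂ fun w : ℂ => (w ^ 2 - (R : ℂ) ^ 2) * G w := by fun_prop
    have hb : ‖(z ^ 2 - (R : ℂ) ^ 2) * G z‖ ≤ 2 * R * C := by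
      refine Complex.norm_le_of_forall_mem_frontier_norm_le (U := Metric.ball (0 : ℂ) R)
        Metric.isBounded_ball hd.diffContOnCl (fun w hw => ?_)
        (subset_closure (by simpa using hR))
      rw [frontier_ball _ hR0.ne', mem_sphere_zero_iff_norm] at hw
      have hfac : w ^ 2 - (R : ℂ) ^ 2 = w * (2 * w.im * Complex.I) := by
        have h1 : (R : ℂ) ^ 2 = w * conj w := by
          rw [Complex.mul_conj, Complex.normSq_eq_norm_sq, hw]; push_cast; rfl
        have h2 := Complex.sub_conj w
        push_cast at h2
        rw [h1, ← h2]; ring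
      have hn : ‖w ^ 2 - (R : ℂ) ^ 2‖ = 2 * R * |w.im| := by
        rw [hfac]; simp [hw]; ring
      rw [norm_mul, hn]
      by_cases him : w.im = 0
      · simp only [him, abs_zero, mul_zero, zero_mul]; positivity
      · calc 2 * R * |w.im| * ‖G w‖ = 2 * R * (‖G w‖ * |w.im|) := by ring
          _ ≤ _ := by gcongr; exact h w him
    rw [norm_mul] at hb
    refine le_trans ?_ hb
    rw [mul_comm]
    gcongr
    have := norm_sub_norm_le ((R : ℂ) ^ 2) (z ^ 2)
    rw [norm_sub_rev] at this
    simpa using this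
  by_contra hne
  have ha : 0 < ‖G z‖ := norm_pos_iff.2 hne
  set a := ‖G z‖
  have hm := norm_nonneg z
  set m := ‖z‖
  have hq : 0 ≤ 2 * C / a := by positivity
  -- The left side of `key` is quadratic in `R` and the right side linear; this `R` is already large
  -- enough for a contradiction.
  have h1 := key (m + 2 * C / a + 1) (by linarith)
  have h2 : a * (2 * C / a) = 2 * C := by field_simp
  set q := 2 * C / a
  have h3 : a * ((m + q + 1) ^ 2 - m ^ 2) = (a * q + a) * (m + q + 1) + (a * q + a) * m := by ring
  rw [h3, h2] at h1
  have h4 : 0 ≤ (2 * C + a) * m := by positivity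
  have h5 : 0 < a * (m + q + 1) := by positivity
  nlinarith

theorem eq_zero_of_integral_test_mul_eq_zero {V : ℝ → ℂ} (hV : Continuous V)
    (h : ∀ η, IsTest η → ∫ t in (0 : ℝ)..1, η t * V t = 0) {x : ℝ} (hx : x ∈ Icc (0 : ℝ) 1) :
    V x = 0 := by
  have hae := isOpen_Ioo.ae_eq_zero_of_integral_contDiff_smul_eq_zero (U := Ioo (0 : ℝ) 1)
    (f := V) (μ := volume) (hV.locallyIntegrable.locallyIntegrableOn _) (by
      intro g hg hgc hgs
      have hsupp : tsupport (fun t => (g t : ℂ)) ⊆ tsupport g :=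
        closure_mono fun t ht h0 => ht (by simp [h0])
      have := h (fun t => (g t : ℂ)) ⟨Complex.ofRealCLM.contDiff.comp hg,
        hgc.comp_left Complex.ofReal_zero, hsupp.trans hgs⟩
      rw [intervalIntegral.integral_of_le zero_le_one] at this
      rw [← this]
      refine (setIntegral_eq_integral_of_forall_compl_eq_zero fun y hy => ?_).symm
      have : y ∉ tsupport g := fun h => hy (Ioo_subset_Ioc_self (hgs h))
      simp [image_eq_zero_of_notMem_tsupport this])
  have hz : EqOn V 0 (Ioo 0 1) := by
    refine Measure.eqOn_open_of_ae_eq (μ := volume) ?_ isOpen_Ioo hV.continuousOn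
      continuousOn_const
    exact (ae_restrict_iff' measurableSet_Ioo).2 hae
  have hcl : IsClosed {x | V x = 0} := isClosed_eq hV continuous_const
  have := closure_minimal (s := Ioo (0 : ℝ) 1) (fun x hx => hz hx) hcl
  rw [closure_Ioo zero_ne_one] at this
  exact this hx

/-- The primitive from 0 vanishes to the left of the support of `η`, and to the right of it because
the total integral is zero. -/
theorem exists_isTest_deriv_eq {η : ℝ → ℂ} (hη : IsTest η)
    (h0 : ∫ t in (0 : ℝ)..1, η t = 0) : ∃ φ, IsTest φ ∧ deriv φ = η := by
  have hc := hη.1.continuous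
  have hd : deriv (fun x => ∫ t in (0 : ℝ)..x, η t) = η :=
    funext fun x => hc.deriv_integral _ _ _
  obtain ⟨a, b, ha, hb, hK⟩ : ∃ a b : ℝ, 0 < a ∧ b < 1 ∧ tsupport η ⊆ Icc a b := by
    rcases (tsupport η).eq_empty_or_nonempty with he | hne
    · exact ⟨1 / 2, 1 / 2, by norm_num, by norm_num, by simp [he]⟩
    · obtain ⟨a, haK, ha⟩ := hη.2.1.isCompact.exists_isLeast hne
      obtain ⟨b, hbK, hb⟩ := hη.2.1.isCompact.exists_isGreatest hne
      exact ⟨a, b, (hη.2.2 haK).1, (hη.2.2 hbK).2, fun x hx => ⟨ha hx, hb hx⟩⟩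
  have hz : ∀ t, t ∉ Icc a b → η t = 0 := fun t ht =>
    image_eq_zero_of_notMem_tsupport fun h => ht (hK h)
  have hsub : tsupport (fun x => ∫ t in (0 : ℝ)..x, η t) ⊆ Icc a b := by
    refine closure_minimal (fun x hx => ?_) isClosed_Icc
    by_contra hxn
    refine hx ?_
    simp only
    rcases lt_or_ge x a with hxa | hxa
    · refine (intervalIntegral.integral_congr (g := fun _ => 0) fun t ht => hz t fun h => ?_).trans
        (by simp)
      exact absurd (h.1.trans ht.2) (by simp [ha, hxa])
    · have hxb : b < x := not_le.1 fun h => hxn ⟨hxa, h⟩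
      rw [← intervalIntegral.integral_add_adjacent_intervals (b := 1) (hc.intervalIntegrable _ _)
        (hc.intervalIntegrable _ _), h0, zero_add]
      refine (intervalIntegral.integral_congr (g := fun _ => 0) fun t ht => hz t fun h => ?_).trans
        (by simp)
      exact absurd (ht.1.trans h.2) (by simp [hb, hxb])
  refine ⟨_, ⟨contDiff_infty_iff_deriv.2 ⟨fun x => ?_, by rw [hd]; exact hη.1⟩,
    isCompact_Icc.of_isClosed_subset (isClosed_tsupport _) hsub,
    hsub.trans fun x hx => ⟨ha.trans_le hx.1, hx.2.trans_lt hb⟩⟩, hd⟩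
  exact (hc.integral_hasStrictDerivAt 0 x).hasDerivAt.differentiableAt

theorem exists_isTest_integral_eq_one : ∃ ψ, IsTest ψ ∧ ∫ t in (0 : ℝ)..1, ψ t = 1 := by
  let f : ContDiffBump (1 / 2 : ℝ) := ⟨1 / 8, 1 / 4, by norm_num, by norm_num⟩
  have hts : tsupport (f.normed volume) ⊆ Ioo (0 : ℝ) 1 := by
    rw [f.tsupport_normed_eq, Real.closedBall_eq_Icc]
    exact fun x hx => ⟨by norm_num [f] at hx; linarith, by norm_num [f] at hx; linarith⟩
  refine ⟨fun t => (f.normed volume t : ℂ), ⟨Complex.ofRealCLM.contDiff.comp f.contDiff_normed,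
    f.hasCompactSupport_normed.comp_left Complex.ofReal_zero, Subset.trans ?_ hts⟩, ?_⟩
  · exact closure_mono fun t ht h0 => ht (by simp [h0])
  · rw [intervalIntegral.integral_ofReal, intervalIntegral.integral_of_le zero_le_one,
      setIntegral_eq_integral_of_forall_compl_eq_zero, f.integral_normed, Complex.ofReal_one]
    exact fun y hy => image_eq_zero_of_notMem_tsupport fun h => hy (Ioo_subset_Ioc_self (hts h))

/-- The du Bois-Reymond lemma on the unit interval. -/
theorem eq_of_integral_deriv_test_mul_eq_zero {W : ℝ → ℂ} (hW : Continuous W)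
    (h : ∀ φ, IsTest φ → ∫ t in (0 : ℝ)..1, deriv φ t * W t = 0) {x : ℝ}
    (hx : x ∈ Icc (0 : ℝ) 1) : W x = W 0 := by
  obtain ⟨ψ, hψ, hψ1⟩ := exists_isTest_integral_eq_one
  set c := ∫ t in (0 : ℝ)..1, ψ t * W t with hc
  have hψc := hψ.1.continuous
  have key : ∀ y ∈ Icc (0 : ℝ) 1, W y - c = 0 := fun y hy => by
    refine eq_zero_of_integral_test_mul_eq_zero (V := fun t => W t - c) (by fun_prop)
      (fun η hη => ?_) hy
    have hηc := hη.1.continuous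
    set m := ∫ t in (0 : ℝ)..1, η t with hm
    -- Subtracting `m ψ` makes the mean zero, so the function is the derivative of a test function
    -- and `h` applies.
    have htest : IsTest (η + (-m) • ψ) := hη.add (hψ.smul _)
    obtain ⟨φ, hφ, hd⟩ := exists_isTest_deriv_eq htest (by
      simp only [Pi.add_apply, Pi.smul_apply, smul_eq_mul]
      rw [intervalIntegral.integral_add (hηc.intervalIntegrable _ _)
        ((continuous_const.mul hψc).intervalIntegrable _ _) (f := η) (g := fun t => -m * ψ t),
        intervalIntegral.integral_const_mul, hψ1, ← hm]
      ring)
    have h1 := h φ hφ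
    rw [hd] at h1
    have e1 : ∀ t, (η + (-m) • ψ) t * W t = η t * W t - m * (ψ t * W t) := fun t => by
      simp only [Pi.add_apply, Pi.smul_apply, smul_eq_mul]; ring
    simp_rw [e1] at h1
    rw [intervalIntegral.integral_sub ((hηc.mul hW).intervalIntegrable _ _)
      ((continuous_const.mul (hψc.mul hW)).intervalIntegrable _ _)
      (f := fun t => η t * W t) (g := fun t => m * (ψ t * W t)),
      intervalIntegral.integral_const_mul, ← hc] at h1
    simp_rw [mul_sub]
    rw [intervalIntegral.integral_sub ((hηc.mul hW).intervalIntegrable _ _)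
      ((hηc.mul continuous_const).intervalIntegrable _ _)
      (f := fun t => η t * W t) (g := fun t => η t * c),
      intervalIntegral.integral_mul_const, ← hm]
    exact h1
  rw [sub_eq_zero.1 (key x hx), sub_eq_zero.1 (key 0 (by simp))]

/-! ### Symmetric relations and nonreal points -/

section Relations

variable {H : Type*} [NormedAddCommGroup H] [InnerProductSpace ℂ H]

/-- Symmetry makes `⟪p.1, p.2⟫` real, so the imaginary part of `⟪p.1, p.2 - z p.1⟫` is `-Im z
‖p.1‖²`; Cauchy-Schwarz finishes. -/
theorem abs_im_mul_norm_le {p : H × H} (hp : inner ℂ p.2 p.1 = inner ℂ p.1 p.2) (z : ℂ) :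
    |z.im| * ‖p.1‖ ≤ ‖p.2 - z • p.1‖ := by
  rcases eq_or_ne p.1 0 with h0 | h0
  · simp [h0]
  have him : (inner ℂ p.1 p.2).im = 0 := by
    have h1 := inner_conj_symm (𝕜 := ℂ) p.1 p.2
    rw [hp] at h1
    exact Complex.conj_eq_iff_im.1 h1
  have h2 : (inner ℂ p.1 (p.2 - z • p.1)).im = -(z.im * ‖p.1‖ ^ 2) := by
    have h3 : inner ℂ p.1 p.1 = ((‖p.1‖ ^ 2 : ℝ) : ℂ) := by
      rw [inner_self_eq_norm_sq_to_K]; push_cast; rfl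
    rw [inner_sub_right, inner_smul_right, h3, Complex.sub_im, him, Complex.im_mul_ofReal]
    ring
  have h3 : |z.im| * ‖p.1‖ ^ 2 ≤ ‖p.1‖ * ‖p.2 - z • p.1‖ := by
    calc |z.im| * ‖p.1‖ ^ 2 = |(inner ℂ p.1 (p.2 - z • p.1)).im| := by
          rw [h2, abs_neg, abs_mul, abs_of_nonneg (sq_nonneg ‖p.1‖)]
      _ ≤ ‖inner ℂ p.1 (p.2 - z • p.1)‖ := Complex.abs_im_le_norm _
      _ ≤ _ := norm_inner_le_norm _ _
  have h4 : 0 < ‖p.1‖ := norm_pos_iff.2 h0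
  nlinarith

/-- For a closed symmetric relation and a nonreal `z`, the range of `p ↦ p.2 - z p.1` is closed, so
that it splits every vector orthogonally. -/
theorem exists_mem_sub_smul_orthogonal [CompleteSpace H] {G : Submodule ℂ (H × H)}
    (hcl : IsClosed (G : Set (H × H)))
    (hsym : ∀ p ∈ G, inner ℂ p.2 p.1 = inner ℂ p.1 p.2) {z : ℂ} (hz : z.im ≠ 0) (g : H) :
    ∃ p ∈ G, ∀ q ∈ G, inner ℂ (q.2 - z • q.1) (g - (p.2 - z • p.1)) = 0 := by
  let T : G →L[ℂ] H := (ContinuousLinearMap.snd ℂ H H - z • ContinuousLinearMap.fst ℂ H H).comp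
    G.subtypeL
  have hT : ∀ p : G, T p = p.1.2 - z • p.1.1 := fun p => rfl
  have hz0 : 0 < |z.im| := abs_pos.2 hz
  -- The range is closed because the map is bounded below in the graph norm: both components of `p`
  -- are controlled by `p.2 - z p.1`.
  have hanti : AntilipschitzWith ⟨1 / |z.im| + (1 + ‖z‖ / |z.im|), by positivity⟩ T := by
    refine AddMonoidHomClass.antilipschitz_of_bound T fun p => ?_
    have h1 := abs_im_mul_norm_le (hsym p.1 p.2) z
    rw [hT]
    set r := p.1.2 - z • p.1.1 with hr
    have h1' : ‖p.1.1‖ ≤ 1 / |z.im| * ‖r‖ := by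
      rw [div_mul_eq_mul_div, le_div_iff₀ hz0]; linarith
    have h2 : ‖p.1.2‖ ≤ (1 + ‖z‖ / |z.im|) * ‖r‖ := by
      have : p.1.2 = r + z • p.1.1 := by rw [hr]; abel
      calc ‖p.1.2‖ ≤ ‖r‖ + ‖z • p.1.1‖ := by rw [this]; exact norm_add_le _ _
        _ ≤ ‖r‖ + ‖z‖ * (1 / |z.im| * ‖r‖) := by rw [norm_smul]; gcongr
        _ = _ := by ring
    change max ‖p.1.1‖ ‖p.1.2‖ ≤ (1 / |z.im| + (1 + ‖z‖ / |z.im|)) * ‖r‖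
    have h3 : 0 ≤ 1 / |z.im| * ‖r‖ := by positivity
    have h4 : 0 ≤ (1 + ‖z‖ / |z.im|) * ‖r‖ := by positivity
    rw [add_mul]
    exact max_le (by linarith) (by linarith)
  have : CompleteSpace G := hcl.completeSpace_coe
  have hrc : IsClosed ((LinearMap.range T.toLinearMap : Submodule ℂ H) : Set H) :=
    hanti.isClosed_range T.uniformContinuous
  have : CompleteSpace (LinearMap.range T.toLinearMap : Submodule ℂ H) := hrc.completeSpace_coe
  obtain ⟨y, ⟨p, rfl⟩, w, hw, hg⟩ :=
    (LinearMap.range T.toLinearMap).exists_add_mem_mem_orthogonal g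
  refine ⟨p.1, p.2, fun q hq => ?_⟩
  have : g - (p.1.2 - z • p.1.1) = w := by rw [hg]; exact add_sub_cancel_left (T p) w
  rw [this]
  exact hw _ ⟨⟨q, hq⟩, rfl⟩

end Relations

/-! ### The adjoint of `-i D_F` -/

theorem inner_smear {φ : ℝ → ℂ} (hφ : Continuous φ) (f : HF) :
    inner ℂ (smear φ) f = ∫ t in (0 : ℝ)..1, conj (φ t) * evalR f t := by
  have h1 : inner ℂ (smear φ) f = ∫ y : unitInterval, conj (φ y) * evalR f y := by
    rw [← inner_conj_symm, smear, ← integral_inner (integrable_smear hφ), ← integral_conj]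
    refine integral_congr_ae (Eventually.of_forall fun y => ?_)
    simp only [inner_conj_symm, inner_smul_left, inner_kvec, evalR]
    rw [projIcc_val]
  rw [h1, intervalIntegral.integral_of_le zero_le_one, ← integral_Icc_eq_integral_Ioc]
  exact integral_subtype (s := unitInterval) measurableSet_Icc
    (fun y : ℝ => conj (φ y) * evalR f y)

theorem mem_graph_opS {p : HF × HF} :
    p ∈ opS.graph ↔ ∃ φ, IsTest φ ∧ p = (smear φ, (-Complex.I) • smear (deriv φ)) := by
  constructor
  · intro hp
    obtain ⟨⟨a, ha⟩, h1, h2⟩ := (LinearPMap.mem_graph_iff _).1 hp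
    have hmem : (a, opD ⟨a, ha⟩) ∈ graphD := opD_graph ▸ LinearPMap.mem_graph opD ⟨a, ha⟩
    obtain ⟨φ, hφ, he⟩ := hmem
    refine ⟨φ, hφ, Prod.ext (h1.symm.trans (congrArg Prod.fst he)) (h2.symm.trans ?_)⟩
    exact congrArg (fun z => (-Complex.I) • z) (congrArg Prod.snd he)
  · rintro ⟨φ, hφ, rfl⟩
    have hmem : (smear φ, smear (deriv φ)) ∈ opD.graph := opD_graph ▸ ⟨φ, hφ, rfl⟩
    obtain ⟨x, h1, h2⟩ := (LinearPMap.mem_graph_iff _).1 hmem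
    refine (LinearPMap.mem_graph_iff _).2 ⟨x, h1, ?_⟩
    exact congrArg (fun z => (-Complex.I) • z) h2

theorem IsTest.conj {φ : ℝ → ℂ} (hφ : IsTest φ) : IsTest (fun t => conj (φ t)) := by
  have hs : tsupport (fun t => conj (φ t)) ⊆ tsupport φ :=
    closure_mono fun t ht h0 => ht (by simp [h0])
  exact ⟨Complex.conjCLE.contDiff.comp hφ.1, hφ.2.1.comp_left (map_zero _), hs.trans hφ.2.2⟩

theorem deriv_conj_test {φ : ℝ → ℂ} (hφ : IsTest φ) (t : ℝ) :
    _root_.deriv (fun t => conj (φ t)) t = conj (_root_.deriv φ t) := by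
  have h : HasDerivAt φ (_root_.deriv φ t) t :=
    (hφ.1.differentiable (by simp)).differentiableAt.hasDerivAt
  exact (Complex.conjCLE.toContinuousLinearMap.hasFDerivAt.comp_hasDerivAt t h).deriv

theorem IsTest.eq_zero {φ : ℝ → ℂ} (hφ : IsTest φ) {t : ℝ} (ht : t ∉ Ioo (0 : ℝ) 1) : φ t = 0 :=
  image_eq_zero_of_notMem_tsupport fun h => ht (hφ.2.2 h)

theorem integral_test_mul {φ b : ℝ → ℂ} (hφ : IsTest φ) (hb : Continuous b) :
    ∫ t in (0 : ℝ)..1, φ t * b t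
      = -∫ t in (0 : ℝ)..1, _root_.deriv φ t * ∫ s in (0 : ℝ)..t, b s := by
  rw [intervalIntegral.integral_mul_deriv_eq_deriv_mul (u' := _root_.deriv φ)
    (v := fun t => ∫ s in (0 : ℝ)..t, b s)
    (fun t _ => (hφ.1.differentiable (by simp)).differentiableAt.hasDerivAt)
    (fun t _ => (hb.integral_hasStrictDerivAt 0 t).hasDerivAt)
    (hφ.deriv.1.continuous.intervalIntegrable _ _) (hb.intervalIntegrable _ _),
    hφ.eq_zero (by simp), hφ.eq_zero (by simp)]
  simp

theorem integral_deriv_test {φ : ℝ → ℂ} (hφ : IsTest φ) :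
    ∫ t in (0 : ℝ)..1, _root_.deriv φ t = 0 := by
  rw [intervalIntegral.integral_deriv_eq_sub
    (fun t _ => (hφ.1.differentiable (by simp)).differentiableAt)
    (hφ.deriv.1.continuous.intervalIntegrable _ _), hφ.eq_zero (by simp), hφ.eq_zero (by simp),
    sub_zero]

theorem continuous_primitive {b : ℝ → ℂ} (hb : Continuous b) :
    Continuous fun t => ∫ s in (0 : ℝ)..t, b s :=
  continuous_iff_continuousAt.2 fun t =>
    (hb.integral_hasStrictDerivAt 0 t).hasDerivAt.continuousAt

theorem evalR_coe (f : HF) (x : unitInterval) : evalR f x = f x := by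
  rw [evalR, projIcc_val]

theorem evalR_zero (f : HF) : evalR f 0 = f 0 := evalR_coe f 0

/-- The adjoint relation of `-i D_F` is the maximal relation `-i d/dx`. -/
theorem adjoint_graph_opS : opS.graph.adjoint = primRel := by
  ext ⟨a, b⟩
  have hcb := continuous_primitive (continuous_evalR b)
  have hca := continuous_evalR a
  -- Integration by parts turns the adjoint condition into orthogonality of `W` to all derivatives
  -- of test functions. This holds exactly when `W` is constant on `[0, 1]`, which is the integrated
  -- equation `-i a' = b`.
  set W : ℝ → ℂ := fun t => Complex.I * evalR a t + ∫ s in (0 : ℝ)..t, evalR b s with hWdef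
  have hW : Continuous W := by fun_prop
  have key : ∀ φ, IsTest φ → inner ℂ ((-Complex.I) • smear (_root_.deriv φ)) a - inner ℂ (smear φ) b
      = ∫ t in (0 : ℝ)..1, conj (_root_.deriv φ t) * W t := by
    intro φ hφ
    have hd := hφ.deriv.1.continuous
    have hdc : Continuous fun t => conj (_root_.deriv φ t) := Complex.continuous_conj.comp hd
    rw [inner_smul_left, inner_smear hd, inner_smear hφ.1.continuous,
      integral_test_mul hφ.conj (continuous_evalR b), ← intervalIntegral.integral_const_mul,
      sub_neg_eq_add, ← intervalIntegral.integral_add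
        (Continuous.intervalIntegrable (by fun_prop) _ _)
        (Continuous.intervalIntegrable (by simp_rw [deriv_conj_test hφ]; fun_prop) _ _)]
    refine intervalIntegral.integral_congr fun t _ => ?_
    simp only [deriv_conj_test hφ, hWdef, map_neg, Complex.conj_I]
    ring
  rw [Submodule.mem_adjoint_iff]
  constructor
  · intro h x
    have h0 : ∀ φ, IsTest φ → ∫ t in (0 : ℝ)..1, _root_.deriv φ t * W t = 0 := fun φ hφ => by
      have := key _ hφ.conj
      rw [h _ _ (mem_graph_opS.2 ⟨_, hφ.conj, rfl⟩)] at this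
      rw [this]
      simp [deriv_conj_test hφ]
    have h1 := eq_of_integral_deriv_test_mul_eq_zero hW h0 x.2
    simp only [hWdef, intervalIntegral.integral_same, add_zero, evalR_zero, evalR_coe] at h1
    linear_combination -Complex.I * h1 + (a x - a 0) * Complex.I_mul_I
  · rintro h x y hxy
    obtain ⟨φ, hφ, he⟩ := mem_graph_opS.1 hxy
    obtain ⟨rfl, rfl⟩ := Prod.mk.inj he
    have hconst : ∀ t ∈ uIcc (0 : ℝ) 1, conj (_root_.deriv φ t) * W t
        = conj (_root_.deriv φ t * conj (Complex.I * a 0)) := fun t ht => by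
      rw [uIcc_of_le zero_le_one] at ht
      have h2 := h ⟨t, ht⟩
      have h3 := evalR_coe a ⟨t, ht⟩
      simp only at h2 h3
      rw [map_mul, Complex.conj_conj]
      simp only [hWdef, h3, h2]
      linear_combination conj (_root_.deriv φ t) * (∫ s in (0 : ℝ)..t, evalR b s) *
        Complex.I_mul_I
    rw [key φ hφ, intervalIntegral.integral_congr hconst, intervalIntegral.intervalIntegral_conj,
      intervalIntegral.integral_mul_const, integral_deriv_test hφ]
    simp

theorem adjoint_topologicalClosure {H : Type*} [NormedAddCommGroup H] [InnerProductSpace ℂ H]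
    (G : Submodule ℂ (H × H)) : G.topologicalClosure.adjoint = G.adjoint := by
  ext p
  simp only [Submodule.mem_adjoint_iff]
  refine ⟨fun h a b hab => h a b (G.le_topologicalClosure hab), fun h a b hab => ?_⟩
  have hcl : IsClosed {q : H × H | inner ℂ q.2 p.1 - inner ℂ q.1 p.2 = 0} :=
    isClosed_eq (by fun_prop) continuous_const
  exact closure_minimal (fun q hq => h q.1 q.2 hq) hcl hab

theorem isClosed_adjoint {H : Type*} [NormedAddCommGroup H] [InnerProductSpace ℂ H]
    (G : Submodule ℂ (H × H)) : IsClosed (G.adjoint : Set (H × H)) := by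
  have : (G.adjoint : Set (H × H))
      = ⋂ q ∈ G, {p : H × H | inner ℂ q.2 p.1 - inner ℂ q.1 p.2 = 0} := by
    ext p
    simp [Submodule.mem_adjoint_iff]
  rw [this]
  exact isClosed_biInter fun q _ => isClosed_eq (by fun_prop) continuous_const

theorem closure_graph_opS_le : opS.graph.topologicalClosure ≤ primRel :=
  le_sup_left.trans (graphA_le_primRel 0)

theorem inner_eq_of_mem_closure {p q : HF × HF} (hp : p ∈ opS.graph.topologicalClosure)
    (hq : q ∈ primRel) : inner ℂ p.2 q.1 = inner ℂ p.1 q.2 := by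
  rw [← adjoint_graph_opS, ← adjoint_topologicalClosure, Submodule.mem_adjoint_iff] at hq
  exact sub_eq_zero.1 (hq p.1 p.2 hp)

/-! ### Deficiency vectors and von Neumann's decomposition -/

/-- Variation of constants for `-i u' = f + z u`. -/
theorem apply_eq_of_mem_primRel {u f : HF} {z : ℂ} (h : (u, f + z • u) ∈ primRel)
    (x : unitInterval) : u x = Complex.exp (Complex.I * z * x) *
      (u 0 + Complex.I * ∫ t in (0 : ℝ)..x, Complex.exp (-(Complex.I * z * t)) * evalR f t) := by
  set e : ℝ → ℂ := fun t => Complex.exp (-(Complex.I * z * t)) with he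
  have hed : ∀ t : ℝ, HasDerivAt e (-(Complex.I * z) * e t) t := fun t => by
    have h1 : HasDerivAt (fun t : ℝ => -(Complex.I * z * (t : ℂ))) (-(Complex.I * z)) t := by
      simpa using ((Complex.ofRealCLM.hasDerivAt (x := t)).const_mul (Complex.I * z)).fun_neg
    simpa [he, mul_comm] using h1.cexp
  have hec : Continuous e := by fun_prop
  have hfc := continuous_evalR f
  have hgc := continuous_evalR (f + z • u)
  -- `U` agrees with `u` on `[0, 1]` but is differentiable on all of `ℝ`, so the endpoints need no
  -- separate treatment.
  set U : ℝ → ℂ := fun t => u 0 + Complex.I * ∫ s in (0 : ℝ)..t, evalR (f + z • u) s with hU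
  have hUd : ∀ t, HasDerivAt U (Complex.I * evalR (f + z • u) t) t := fun t =>
    (((hgc.integral_hasStrictDerivAt 0 t).hasDerivAt).const_mul _).const_add _
  have hUu : ∀ t ∈ Icc (0 : ℝ) 1, U t = evalR u t := fun t ht => by
    rw [evalR_coe u ⟨t, ht⟩]; exact (h ⟨t, ht⟩).symm
  set K : ℝ → ℂ := fun t => e t * U t - Complex.I * ∫ s in (0 : ℝ)..t, e s * evalR f s with hK
  have hKd : ∀ t ∈ Icc (0 : ℝ) 1, HasDerivAt K 0 t := fun t ht => by
    have h1 := ((hed t).mul (hUd t)).sub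
      ((((hec.mul hfc).integral_hasStrictDerivAt 0 t).hasDerivAt).const_mul Complex.I)
    refine h1.congr_deriv ?_
    have h2 : evalR (f + z • u) t = evalR f t + z * evalR u t := by simp [evalR]
    simp only [Pi.mul_apply]
    rw [h2, hUu t ht]
    ring
  have hconst := constant_of_has_deriv_right_zero (f := K) (a := 0) (b := 1)
    (fun t ht => (hKd t ht).continuousAt.continuousWithinAt)
    (fun t ht => (hKd t (Ico_subset_Icc_self ht)).hasDerivWithinAt) x x.2
  have hx := hUu x x.2
  rw [evalR_coe] at hx
  simp only [hK, hx] at hconst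
  have h0 : e 0 * U 0 = u 0 := by simp [he, hU]
  rw [h0, intervalIntegral.integral_same, mul_zero, sub_zero] at hconst
  rw [← hconst, sub_add_cancel, ← mul_assoc, he, ← Complex.exp_add]
  simp

theorem apply_eq_of_smul_mem_primRel {u : HF} {z : ℂ} (h : (u, z • u) ∈ primRel)
    (x : unitInterval) : u x = Complex.exp (Complex.I * z * x) * u 0 := by
  have h' : (u, (0 : HF) + z • u) ∈ primRel := by rwa [zero_add]
  rw [apply_eq_of_mem_primRel h' x]
  simp [evalR]

theorem kvec_zero_apply (x : unitInterval) : kvec 0 x = Complex.exp (-x) := by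
  rw [kvec_apply, F]
  simp [abs_of_nonneg x.2.1]

theorem kvec_one_apply (x : unitInterval) : kvec 1 x = Complex.exp (x - 1) := by
  rw [kvec_apply, F, Icc.coe_one, abs_of_nonpos (by linarith [x.2.2])]
  simp

theorem kvec_zero_mem_primRel : (kvec 0, Complex.I • kvec 0) ∈ primRel := by
  simpa using kvec_mem_primRel 0

theorem eq_smul_kvec_zero {u : HF} (h : (u, Complex.I • u) ∈ primRel) : u = u 0 • kvec 0 := by
  refine RKHS.ext fun x => ?_
  rw [apply_eq_of_smul_mem_primRel h x, Complex.I_mul_I, RKHS.coe_smul, Pi.smul_apply,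
    kvec_zero_apply, smul_eq_mul, mul_comm]
  simp

theorem eq_smul_kvec_one {u : HF} (h : (u, -Complex.I • u) ∈ primRel) :
    u = (Complex.exp 1 * u 0) • kvec 1 := by
  refine RKHS.ext fun x => ?_
  rw [apply_eq_of_smul_mem_primRel h x, RKHS.coe_smul, Pi.smul_apply, mul_neg, Complex.I_mul_I,
    kvec_one_apply, smul_eq_mul, mul_right_comm, ← Complex.exp_add]
  simp

/-- Von Neumann's decomposition of the adjoint of `-i D_F`. -/
theorem exists_decomposition {p : HF × HF} (hp : p ∈ primRel) :
    ∃ s ∈ opS.graph.topologicalClosure, ∃ a b : ℂ,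
      p = s + a • (kvec 0, Complex.I • kvec 0) + b • (kvec 1, -Complex.I • kvec 1) := by
  obtain ⟨s, hs, hr⟩ := exists_mem_sub_smul_orthogonal
    (G := opS.graph.topologicalClosure) (Submodule.isClosed_topologicalClosure _)
    (fun p hp => inner_eq_of_mem_closure hp (closure_graph_opS_le hp))
    (z := -Complex.I) (by simp) (p.2 + Complex.I • p.1)
  set r := p.2 + Complex.I • p.1 - (s.2 - -Complex.I • s.1) with hrdef
  have hrmem : (r, Complex.I • r) ∈ primRel := by
    rw [← adjoint_graph_opS, ← adjoint_topologicalClosure, Submodule.mem_adjoint_iff]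
    intro a b hab
    have := hr (a, b) hab
    simp only [inner_sub_left, inner_smul_left, map_neg, Complex.conj_I] at this
    simp only [inner_smul_right]
    linear_combination this
  have hr0 := eq_smul_kvec_zero hrmem
  -- Applying `-i d/dx + i` to `a e^{-x}` gives `2i a e^{-x}`; this `a` makes it equal to `r`, so
  -- the remainder `q` is an eigenvector at `-i`.
  set a : ℂ := -(Complex.I / 2) * r 0 with ha
  have hp' : p - s - a • (kvec 0, Complex.I • kvec 0) ∈ primRel :=
    primRel.sub_mem (primRel.sub_mem hp (closure_graph_opS_le hs))
      (primRel.smul_mem _ kvec_zero_mem_primRel)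
  set q := p - s - a • (kvec 0, Complex.I • kvec 0) with hq
  have hq2 : q.2 = -Complex.I • q.1 := by
    have h1 : p.2 + Complex.I • p.1 - (s.2 - -Complex.I • s.1) - r 0 • kvec 0 = 0 := by
      rw [← hrdef, ← hr0, sub_self]
    rw [← sub_eq_zero, ← h1, hq, ha]
    simp only [Prod.snd_sub, Prod.fst_sub, Prod.smul_fst, Prod.smul_snd]
    match_scalars
    · simp
    · simp
    · linear_combination r 0 * Complex.I_mul_I
    all_goals simp
  have hq' : q = (q.1, -Complex.I • q.1) := Prod.ext rfl hq2
  rw [hq'] at hp'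
  have hq1 := eq_smul_kvec_one hp'
  refine ⟨s, hs, a, Complex.exp 1 * q.1 0, ?_⟩
  have : q = (Complex.exp 1 * q.1 0) • (kvec 1, -Complex.I • kvec 1) := by
    refine Prod.ext hq1 (hq2.trans ?_)
    rw [Prod.smul_snd, smul_comm]
    exact congrArg _ hq1
  rw [← this, hq]
  abel

/-! ### The boundary form and selfadjointness -/

/-- The vector of `graphA θ` that is not in the closure of `-i D_F`. -/
def bdry (θ : ℝ) : HF × HF :=
  (kvec 0 + Complex.exp (Complex.I * θ) • kvec 1,
      Complex.I • (kvec 0 - Complex.exp (Complex.I * θ) • kvec 1))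

theorem conj_exp_I_mul (θ : ℝ) :
    conj (Complex.exp (Complex.I * θ)) = Complex.exp (-(Complex.I * θ)) := by
  rw [← Complex.exp_conj]; simp

theorem exp_I_mul_neg (θ : ℝ) :
    Complex.exp (Complex.I * θ) * Complex.exp (-(Complex.I * θ)) = 1 := by
  rw [← Complex.exp_add, add_neg_cancel, Complex.exp_zero]

theorem mem_adjoint_graphA {θ : ℝ} {p : HF × HF} :
    p ∈ (graphA θ).adjoint ↔ p ∈ primRel ∧
      inner ℂ (bdry θ).2 p.1 - inner ℂ (bdry θ).1 p.2 = 0 := by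
  rw [← adjoint_graph_opS, ← adjoint_topologicalClosure opS.graph]
  simp only [Submodule.mem_adjoint_iff]
  constructor
  · exact fun h => ⟨fun a b hab => h a b (Submodule.mem_sup_left hab),
      h _ _ (Submodule.mem_sup_right (Submodule.mem_span_singleton_self _))⟩
  · rintro ⟨h1, h2⟩ a b hab
    obtain ⟨s, hs, v, hv, he⟩ := Submodule.mem_sup.1 hab
    obtain ⟨c, rfl⟩ := Submodule.mem_span_singleton.1 hv
    have ha : a = s.1 + c • (bdry θ).1 := (congrArg Prod.fst he).symm
    have hb : b = s.2 + c • (bdry θ).2 := (congrArg Prod.snd he).symm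
    rw [ha, hb, inner_add_left, inner_add_left, inner_smul_left, inner_smul_left]
    linear_combination h1 _ _ hs + conj c * h2

theorem inner_bdry (θ : ℝ) (p : HF × HF) :
    inner ℂ (bdry θ).2 p.1 - inner ℂ (bdry θ).1 p.2
      = -Complex.I * (p.1 0 - Complex.exp (-(Complex.I * θ)) * p.1 1)
        - (p.2 0 + Complex.exp (-(Complex.I * θ)) * p.2 1) := by
  simp only [bdry, inner_smul_left, inner_add_left, inner_sub_left, inner_kvec, Complex.conj_I,
    conj_exp_I_mul]

/-- The boundary condition that characterizes `A_θ`. -/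
theorem mem_adjoint_graphA_iff {θ : ℝ} {p : HF × HF} :
    p ∈ (graphA θ).adjoint ↔ p ∈ primRel ∧
      -Complex.I * (p.1 0 - Complex.exp (-(Complex.I * θ)) * p.1 1)
        - (p.2 0 + Complex.exp (-(Complex.I * θ)) * p.2 1) = 0 := by
  rw [mem_adjoint_graphA, inner_bdry]

theorem bdry_mem_primRel (θ : ℝ) : bdry θ ∈ primRel := kvec_mem_primRel _

theorem kvec_self (x : unitInterval) : kvec x x = 1 := by simp [kvec_apply, F]

theorem kvec_zero_one : kvec 0 1 = kvec 1 0 := by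
  rw [kvec_zero_apply, kvec_one_apply]; simp

/-- `A_θ` is selfadjoint, in terms of its graph. -/
theorem adjoint_graphA (θ : ℝ) : (graphA θ).adjoint = graphA θ := by
  have he := exp_I_mul_neg θ
  apply le_antisymm
  · intro p hp
    rw [mem_adjoint_graphA] at hp
    obtain ⟨s, hs, a, b, rfl⟩ := exists_decomposition hp.1
    have h2 := hp.2
    have h3 : inner ℂ (bdry θ).2 s.1 - inner ℂ (bdry θ).1 s.2 = 0 := by
      have := inner_eq_of_mem_closure hs (bdry_mem_primRel θ)
      rw [← inner_conj_symm, ← this, ← inner_conj_symm (bdry θ).1, sub_self]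
    rw [inner_bdry] at h2 h3
    simp only [Prod.fst_add, Prod.snd_add, Prod.smul_fst, Prod.smul_snd, RKHS.coe_add,
      RKHS.coe_smul, Pi.add_apply, Pi.smul_apply, smul_eq_mul, kvec_self, kvec_zero_one] at h2
    -- The boundary form vanishes on `s`, and equals `-2i` and `2i e^{-iθ}` on the two deficiency
    -- pairs, which leaves one linear equation.
    have hab : a = Complex.exp (-(Complex.I * θ)) * b := by
      linear_combination (Complex.I / 2) * (h2 - h3)
        + (a - Complex.exp (-(Complex.I * θ)) * b) * Complex.I_mul_I
    have hb : b = a * Complex.exp (Complex.I * θ) := by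
      rw [hab]; linear_combination -b * he
    rw [add_assoc]
    refine Submodule.add_mem_sup hs (Submodule.mem_span_singleton.2 ⟨a, ?_⟩)
    rw [hb]
    ext1
    · simp only [Prod.smul_fst, Prod.fst_add]
      module
    · simp only [Prod.smul_snd, Prod.snd_add]
      module
  · refine sup_le (fun s hs => mem_adjoint_graphA.2 ⟨closure_graph_opS_le hs, ?_⟩)
      ((Submodule.span_singleton_le_iff_mem _ _).2
        (mem_adjoint_graphA.2 ⟨bdry_mem_primRel θ, ?_⟩))
    · have := inner_eq_of_mem_closure hs (bdry_mem_primRel θ)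
      rw [← inner_conj_symm, ← this, ← inner_conj_symm (bdry θ).1]
      simp
    · change inner ℂ (bdry θ).2 (bdry θ).1 - inner ℂ (bdry θ).1 (bdry θ).2 = 0
      rw [inner_bdry]
      simp only [bdry, RKHS.coe_add, RKHS.coe_sub,
        RKHS.coe_smul, Pi.add_apply, Pi.sub_apply, Pi.smul_apply, smul_eq_mul, kvec_self,
        kvec_zero_one]
      linear_combination 2 * Complex.I * he

theorem isClosed_graphA (θ : ℝ) : IsClosed (graphA θ : Set (HF × HF)) := by
  rw [← adjoint_graphA]; exact isClosed_adjoint _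

theorem mem_graphA_iff {θ : ℝ} {p : HF × HF} :
    p ∈ graphA θ ↔ p ∈ primRel ∧
      -Complex.I * (p.1 0 - Complex.exp (-(Complex.I * θ)) * p.1 1)
        - (p.2 0 + Complex.exp (-(Complex.I * θ)) * p.2 1) = 0 := by
  rw [← mem_adjoint_graphA_iff, adjoint_graphA]

theorem inner_eq_of_mem_graphA {θ : ℝ} {p q : HF × HF} (hp : p ∈ graphA θ) (hq : q ∈ graphA θ) :
    inner ℂ p.2 q.1 = inner ℂ p.1 q.2 := by
  rw [← adjoint_graphA, Submodule.mem_adjoint_iff] at hq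
  exact sub_eq_zero.1 (hq p.1 p.2 hp)

theorem opS_le_opA (θ : ℝ) : opS ≤ opA θ := by
  refine LinearPMap.le_of_le_graph ?_
  rw [opA_graph]
  exact (Submodule.le_topologicalClosure _).trans le_sup_left

theorem dense_domain_opA (θ : ℝ) : Dense ((opA θ).domain : Set HF) := by
  rw [Submodule.dense_iff_topologicalClosure_eq_top,
    Submodule.topologicalClosure_eq_top_iff, Submodule.eq_bot_iff]
  intro f hf
  have hmem : ((0 : HF), f) ∈ (graphA θ).adjoint := by
    rw [Submodule.mem_adjoint_iff]
    intro a b hab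
    rw [← opA_graph] at hab
    have := hf a (LinearPMap.mem_domain_of_mem_graph hab)
    simp [this]
  rw [adjoint_graphA] at hmem
  exact primRel_functional _ (graphA_le_primRel θ hmem) rfl

theorem isSelfAdjoint_opA (θ : ℝ) : IsSelfAdjoint (opA θ) := by
  rw [LinearPMap.isSelfAdjoint_def]
  apply LinearPMap.eq_of_eq_graph
  rw [LinearPMap.adjoint_graph_eq_graph_adjoint (dense_domain_opA θ), opA_graph, adjoint_graphA]

/-! ### Exponentials in `H_F` and the secular function -/

/-- The secular function, whose zeros are the eigenvalues of `A_θ`. -/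
def secular (θ : ℝ) (z : ℂ) : ℂ :=
  Complex.exp (Complex.I * (z - θ)) * (z - Complex.I) + (z + Complex.I)

/-- The element `e^{ilx}` of `H_F`. -/
def expVec (l : ℝ) : HF :=
  ((1 + (l : ℂ) ^ 2) / 2) • smear (fun y => Complex.exp (Complex.I * l * y))
    + ((1 - Complex.I * l) / 2) • kvec 0
    + ((1 + Complex.I * l) * Complex.exp (Complex.I * l) / 2) • kvec 1

theorem one_add_I_mul_ne_zero (l : ℝ) : 1 + Complex.I * l ≠ 0 := fun h => by
  simpa using congrArg Complex.re h

theorem one_sub_I_mul_ne_zero (l : ℝ) : 1 - Complex.I * l ≠ 0 := fun h => by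
  simpa using congrArg Complex.re h

theorem integral_exp_mul_F (l : ℝ) {x : ℝ} (hx : x ∈ Icc (0 : ℝ) 1) :
    ∫ y in (0 : ℝ)..1, Complex.exp (Complex.I * l * y) * F (x - y)
      = (Complex.exp (Complex.I * l * x) - Complex.exp (-x)) / (1 + Complex.I * l)
        + (Complex.exp (Complex.I * l * x) - Complex.exp (Complex.I * l) * Complex.exp (x - 1))
          / (1 - Complex.I * l) := by
  have hF : Continuous F := by unfold F; fun_prop
  have h1 : ∀ y ∈ uIcc (0 : ℝ) x, Complex.exp (Complex.I * l * y) * F (x - y)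
      = Complex.exp (-x) * Complex.exp ((1 + Complex.I * l) * y) := by
    intro y hy
    rw [uIcc_of_le hx.1] at hy
    rw [F, abs_of_nonneg (by linarith [hy.2]), Complex.ofReal_exp, ← Complex.exp_add,
      ← Complex.exp_add]
    congr 1; push_cast; ring
  have h2 : ∀ y ∈ uIcc x (1 : ℝ), Complex.exp (Complex.I * l * y) * F (x - y)
      = Complex.exp x * Complex.exp (-(1 - Complex.I * l) * y) := by
    intro y hy
    rw [uIcc_of_le hx.2] at hy
    rw [F, abs_of_nonpos (by linarith [hy.1]), Complex.ofReal_exp, ← Complex.exp_add,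
      ← Complex.exp_add]
    congr 1; push_cast; ring
  rw [← intervalIntegral.integral_add_adjacent_intervals (b := x)
    (Continuous.intervalIntegrable (by fun_prop) _ _)
    (Continuous.intervalIntegrable (by fun_prop) _ _), intervalIntegral.integral_congr h1,
    intervalIntegral.integral_congr h2, intervalIntegral.integral_const_mul,
    intervalIntegral.integral_const_mul, integral_exp_mul_complex (one_add_I_mul_ne_zero l),
    integral_exp_mul_complex (neg_ne_zero.2 (one_sub_I_mul_ne_zero l)), mul_div_assoc',
    mul_div_assoc', mul_sub, mul_sub, div_neg, ← neg_div, neg_sub]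
  simp only [← Complex.exp_add, Complex.ofReal_zero, Complex.ofReal_one]
  ring_nf

/-- `F` is twice a fundamental solution of `1 - d²/dx²`, so `(1 + l²)/2` times the smeared
exponential is `e^{ilx}` up to a combination of `e^{-x}` and `e^{x-1}`. The kernel terms in `expVec`
cancel that combination. -/
theorem expVec_apply (l : ℝ) (x : unitInterval) :
    expVec l x = Complex.exp (Complex.I * l * x) := by
  have hp := one_add_I_mul_ne_zero l
  have hm := one_sub_I_mul_ne_zero l
  have hsq : (1 + (l : ℂ) ^ 2) = (1 + Complex.I * l) * (1 - Complex.I * l) := by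
    linear_combination (l : ℂ) ^ 2 * Complex.I_mul_I
  simp only [expVec, RKHS.coe_add, RKHS.coe_smul, Pi.add_apply, Pi.smul_apply, smul_eq_mul,
    kvec_zero_apply, kvec_one_apply]
  rw [smear_apply (by fun_prop), integral_exp_mul_F l x.2, hsq]
  field_simp
  ring

theorem evalR_expVec (l : ℝ) {t : ℝ} (ht : t ∈ Icc (0 : ℝ) 1) :
    evalR (expVec l) t = Complex.exp (Complex.I * l * t) := by
  rw [evalR_coe _ ⟨t, ht⟩, expVec_apply]

theorem conj_exp_I_mul_mul (l t : ℝ) :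
    conj (Complex.exp (Complex.I * l * t)) = Complex.exp (-(Complex.I * l * t)) := by
  rw [← Complex.exp_conj]; simp

theorem inner_expVec (l : ℝ) (f : HF) : inner ℂ (expVec l) f
    = (1 + (l : ℂ) ^ 2) / 2 * (∫ t in (0 : ℝ)..1, Complex.exp (-(Complex.I * l * t)) * evalR f t)
      + (1 + Complex.I * l) / 2 * f 0
      + (1 - Complex.I * l) * Complex.exp (-(Complex.I * l)) / 2 * f 1 := by
  simp only [expVec, inner_add_left, inner_smul_left, inner_kvec]
  rw [inner_smear (by fun_prop)]
  simp only [conj_exp_I_mul_mul]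
  simp only [map_div₀, map_add, map_mul, map_sub, map_one, map_pow, Complex.conj_ofReal,
    Complex.conj_I, conj_exp_I_mul, map_ofNat]
  ring

theorem inner_expVec_self (l : ℝ) : inner ℂ (expVec l) (expVec l) = ((l : ℂ) ^ 2 + 3) / 2 := by
  have h : ∀ t ∈ uIcc (0 : ℝ) 1, Complex.exp (-(Complex.I * l * t)) * evalR (expVec l) t = 1 := by
    intro t ht
    rw [uIcc_of_le zero_le_one] at ht
    rw [evalR_expVec l ht, ← Complex.exp_add, neg_add_cancel, Complex.exp_zero]
  rw [inner_expVec, intervalIntegral.integral_congr h, expVec_apply, expVec_apply]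
  have := exp_I_mul_neg l
  simp only [intervalIntegral.integral_const, Icc.coe_zero, Icc.coe_one, Complex.ofReal_zero,
    mul_zero, Complex.exp_zero, Complex.ofReal_one, mul_one, sub_zero, one_smul]
  linear_combination (1 - Complex.I * l) / 2 * this

theorem expVec_mem_primRel (l : ℝ) : (expVec l, (l : ℂ) • expVec l) ∈ primRel := by
  intro x
  have h : ∀ t ∈ uIcc (0 : ℝ) x, evalR ((l : ℂ) • expVec l) t
      = -Complex.I * (Complex.I * l * Complex.exp (Complex.I * l * t)) := by
    intro t ht
    rw [uIcc_of_le x.2.1] at ht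
    have := evalR_expVec l ⟨ht.1, ht.2.trans x.2.2⟩
    simp only [evalR, RKHS.coe_smul, Pi.smul_apply, smul_eq_mul] at this ⊢
    rw [this]
    linear_combination l * Complex.exp (Complex.I * l * t) * Complex.I_mul_I
  have hd : ∀ t : ℝ, HasDerivAt (fun t : ℝ => Complex.exp (Complex.I * l * t))
      (Complex.I * l * Complex.exp (Complex.I * l * t)) t := fun t => by
    have h1 : HasDerivAt (fun t : ℝ => Complex.I * l * (t : ℂ)) (Complex.I * l) t := by
      simpa using (Complex.ofRealCLM.hasDerivAt (x := t)).const_mul (Complex.I * (l : ℂ))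
    simpa [mul_comm] using h1.cexp
  simp only
  rw [intervalIntegral.integral_congr h, intervalIntegral.integral_const_mul,
    intervalIntegral.integral_eq_sub_of_hasDerivAt (fun t _ => hd t)
      (Continuous.intervalIntegrable (by fun_prop) _ _), expVec_apply, expVec_apply]
  simp only [Icc.coe_zero, Complex.ofReal_zero, mul_zero, Complex.exp_zero]
  linear_combination (Complex.exp (Complex.I * l * x) - 1) * Complex.I_mul_I

theorem exp_I_mul_sub (z : ℂ) (θ : ℝ) : Complex.exp (Complex.I * (z - θ))
    = Complex.exp (Complex.I * z) * Complex.exp (-(Complex.I * θ)) := by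
  rw [← Complex.exp_add]; congr 1; ring

/-- The boundary expression of `A_θ`, evaluated on `e^{ilx}`, is `-secular θ l`. -/
theorem expVec_mem_graphA_iff {θ l : ℝ} :
    (expVec l, (l : ℂ) • expVec l) ∈ graphA θ ↔ secular θ l = 0 := by
  rw [mem_graphA_iff, and_iff_right (expVec_mem_primRel l), ← neg_eq_zero, secular, exp_I_mul_sub]
  simp only [RKHS.coe_smul, Pi.smul_apply, smul_eq_mul, expVec_apply, Icc.coe_zero, Icc.coe_one,
    Complex.ofReal_zero, mul_zero, Complex.exp_zero, Complex.ofReal_one, mul_one]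
  constructor <;> intro h <;> linear_combination h

theorem expVec_ne_zero (l : ℝ) : expVec l ≠ 0 := fun h => by
  have := expVec_apply l 0
  simp [h] at this

theorem inner_expVec_of_ne {θ l m : ℝ} (hl : secular θ l = 0) (hm : secular θ m = 0)
    (hlm : l ≠ m) : inner ℂ (expVec l) (expVec m) = 0 := by
  have := inner_eq_of_mem_graphA (expVec_mem_graphA_iff.2 hl) (expVec_mem_graphA_iff.2 hm)
  simp only [inner_smul_left, inner_smul_right, Complex.conj_ofReal] at this
  have h2 : ((l : ℂ) - m) * inner ℂ (expVec l) (expVec m) = 0 := by linear_combination this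
  exact (mul_eq_zero.1 h2).resolve_left (sub_ne_zero.2 (by exact_mod_cast hlm))

/-- A zero forces `e^{-Im z} |z - i| = |z + i|`. In the upper half-plane the left side is smaller,
in the lower one it is larger. -/
theorem im_eq_zero_of_secular_eq_zero {θ : ℝ} {z : ℂ} (h : secular θ z = 0) : z.im = 0 := by
  have h1 : Complex.exp (Complex.I * (z - θ)) * (z - Complex.I) = -(z + Complex.I) :=
    eq_neg_of_add_eq_zero_left h
  have h2 := congrArg norm h1
  rw [norm_mul, norm_neg, Complex.norm_exp] at h2
  have h3 : (Complex.I * (z - θ)).re = -z.im := by simp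
  rw [h3] at h2
  have hsq : ‖z + Complex.I‖ ^ 2 - ‖z - Complex.I‖ ^ 2 = 4 * z.im := by
    rw [← Complex.normSq_eq_norm_sq, ← Complex.normSq_eq_norm_sq, Complex.normSq_apply,
      Complex.normSq_apply]
    simp; ring
  have hn := norm_nonneg (z - Complex.I)
  have hn' := norm_nonneg (z + Complex.I)
  rcases lt_trichotomy z.im 0 with hi | hi | hi
  · have : 1 ≤ Real.exp (-z.im) := Real.one_le_exp (by linarith)
    have h4 : ‖z - Complex.I‖ ≤ ‖z + Complex.I‖ := by nlinarith
    nlinarith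
  · exact hi
  · have : Real.exp (-z.im) ≤ 1 := Real.exp_le_one_iff.2 (by linarith)
    have h4 : ‖z + Complex.I‖ ≤ ‖z - Complex.I‖ := by nlinarith
    nlinarith

theorem hasDerivAt_secular (θ : ℝ) (z : ℂ) : HasDerivAt (secular θ)
    (Complex.I * Complex.exp (Complex.I * (z - θ)) * (z - Complex.I)
      + Complex.exp (Complex.I * (z - θ)) + 1) z := by
  have h1 : HasDerivAt (fun z : ℂ => Complex.I * (z - θ)) Complex.I z := by
    simpa using ((hasDerivAt_id z).sub_const (θ : ℂ)).const_mul Complex.I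
  have h2 := (h1.cexp.mul ((hasDerivAt_id z).sub_const Complex.I)).add
    ((hasDerivAt_id z).add_const Complex.I)
  refine h2.congr_deriv ?_
  simp only [id]
  ring

theorem differentiable_secular (θ : ℝ) : Differentiable ℂ (secular θ) := fun z =>
  (hasDerivAt_secular θ z).differentiableAt

/-- The zeros of the secular function are simple. -/
theorem deriv_secular_ne_zero {θ : ℝ} {z : ℂ} (h : secular θ z = 0) : deriv (secular θ) z ≠ 0 := by
  rw [(hasDerivAt_secular θ z).deriv]
  have him := im_eq_zero_of_secular_eq_zero h
  obtain ⟨l, rfl⟩ : ∃ l : ℝ, z = l := ⟨z.re, Complex.ext (by simp) (by simp [him])⟩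
  rw [secular] at h
  set w := Complex.exp (Complex.I * (l - θ))
  intro h0
  -- Eliminating `w` from the equations `secular = 0` and `secular' = 0` leaves `l² + 3 = 0`,
  -- impossible for real `l`.
  have h1 : (l : ℂ) ^ 2 + 3 = 0 := by
    linear_combination -Complex.I * (h - (l - Complex.I) * (h0 - Complex.I * h))
      + ((l : ℂ) ^ 2 + 3 - Complex.I ^ 2) * Complex.I_mul_I
  have h2 : l ^ 2 + 3 = 0 := by exact_mod_cast h1
  nlinarith

/-! ### The resolvent and completeness of the eigenfunctions -/

theorem differentiable_integral_exp_mul (f : HF) (x : ℝ) : Differentiable ℂ fun z : ℂ =>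
    ∫ t in (0 : ℝ)..x, Complex.exp (-(Complex.I * z * t)) * evalR f t := by
  intro z
  have hf := continuous_evalR f
  have hd : ∀ (t : ℝ) (z : ℂ), HasDerivAt
      (fun z : ℂ => Complex.exp (-(Complex.I * z * t)) * evalR f t)
      (Complex.exp (-(Complex.I * z * t)) * -(Complex.I * t) * evalR f t) z := fun t z => by
    have h1 : HasDerivAt (fun z : ℂ => -(Complex.I * z * t)) (-(Complex.I * t)) z := by
      simpa using (((hasDerivAt_id z).const_mul Complex.I).mul_const (t : ℂ)).fun_neg
    exact h1.cexp.mul_const _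
  have hbd : ∃ C : ℝ, ∀ p ∈ Metric.closedBall z 1 ×ˢ uIcc (0 : ℝ) x,
      ‖Complex.exp (-(Complex.I * p.1 * p.2)) * -(Complex.I * p.2) * evalR f p.2‖ ≤ C :=
    ((isCompact_closedBall z 1).prod isCompact_uIcc).exists_bound_of_continuousOn
      (Continuous.continuousOn (by fun_prop))
  obtain ⟨C, hC⟩ := hbd
  exact (intervalIntegral.hasDerivAt_integral_of_dominated_loc_of_deriv_le (𝕜 := ℂ)
    (bound := fun _ => C) (Metric.ball_mem_nhds z one_pos)
    (Eventually.of_forall fun z => Continuous.aestronglyMeasurable (by fun_prop))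
    (Continuous.intervalIntegrable (by fun_prop) _ _)
    (Continuous.aestronglyMeasurable (by fun_prop))
    (Eventually.of_forall fun t ht w hw => hC (w, t)
      ⟨Metric.ball_subset_closedBall hw, uIoc_subset_uIcc ht⟩)
    (intervalIntegrable_const)
    (Eventually.of_forall fun t _ w _ => hd t w)).2.differentiableAt

/-- The numerator of `⟪F_0, (A_θ - z)⁻¹ f⟫`, up to sign. -/
def numer (θ : ℝ) (f : HF) (z : ℂ) : ℂ :=
  Complex.I * (z - Complex.I) * Complex.exp (Complex.I * (z - θ)) *
      (∫ t in (0 : ℝ)..1, Complex.exp (-(Complex.I * z * t)) * evalR f t)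
    + f 0 + Complex.exp (-(Complex.I * θ)) * f 1

theorem differentiable_numer (θ : ℝ) (f : HF) : Differentiable ℂ (numer θ f) := by
  have := differentiable_integral_exp_mul f 1
  unfold numer
  fun_prop

/-- Variation of constants expresses `u(1)` through `u(0)`; inserting it in the boundary condition
gives a linear equation for `u(0)`. -/
theorem secular_mul_apply_zero {θ : ℝ} {u f : HF} {z : ℂ} (h : (u, f + z • u) ∈ graphA θ) :
    secular θ z * u 0 = -numer θ f z := by
  obtain ⟨h1, h2⟩ := mem_graphA_iff.1 h
  have h3 := apply_eq_of_mem_primRel h1 1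
  simp only [Icc.coe_one, Complex.ofReal_one, mul_one] at h3
  simp only [RKHS.coe_add, RKHS.coe_smul, Pi.add_apply, Pi.smul_apply, smul_eq_mul] at h2
  rw [h3] at h2
  rw [secular, numer, exp_I_mul_sub]
  linear_combination -h2

/-- At a zero of `secular θ` one has `(1 + il) numer θ f l = 2 ⟪expVec l, f⟫`. -/
theorem numer_eq_zero {θ l : ℝ} {f : HF} (hl : secular θ l = 0)
    (hf : inner ℂ (expVec l) f = 0) : numer θ f l = 0 := by
  rw [inner_expVec] at hf
  rw [secular, exp_I_mul_sub] at hl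
  rw [numer, exp_I_mul_sub]
  have hp := one_add_I_mul_ne_zero l
  set J := ∫ t in (0 : ℝ)..1, Complex.exp (-(Complex.I * l * t)) * evalR f t
  have he := exp_I_mul_neg l
  set w := Complex.exp (Complex.I * l)
  set w' := Complex.exp (-(Complex.I * l))
  set e' := Complex.exp (-(Complex.I * θ))
  have h1 : e' * (1 + Complex.I * l) = (1 - Complex.I * l) * w' := by
    have h2 : w * e' * (1 + Complex.I * l) = 1 - Complex.I * l := by
      linear_combination Complex.I * hl + (w * e' - 1) * Complex.I_mul_I
    linear_combination w' * h2 - e' * (1 + Complex.I * l) * he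
  refine (mul_eq_zero.1 (?_ : (1 + Complex.I * l) * _ = 0)).resolve_left hp
  linear_combination 2 * hf + f 1 * h1 + (1 + Complex.I * l) * Complex.I * J * hl
    - J * (1 + (l : ℂ) ^ 2 + Complex.I * l) * Complex.I_mul_I

/-- The quotient of entire functions, where the denominator has simple zeros at which the numerator
vanishes, is entire. -/
theorem exists_differentiable_mul_eq {p q : ℂ → ℂ} (hp : Differentiable ℂ p)
    (hq : Differentiable ℂ q) (h0 : ∀ z, q z = 0 → p z = 0) (hd : ∀ z, q z = 0 → deriv q z ≠ 0) :
    ∃ r : ℂ → ℂ, Differentiable ℂ r ∧ ∀ z, q z * r z = p z := by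
  classical
  refine ⟨fun z => if q z = 0 then deriv p z / deriv q z else p z / q z, fun z => ?_, fun z => ?_⟩
  · by_cases hz : q z = 0
    -- Near a zero `z` of `q` the quotient is `dslope p z / dslope q z`, whose denominator does not
    -- vanish at `z`.
    · have hdp : Differentiable ℂ (dslope p z) := fun w => by
        have := (Complex.differentiableOn_dslope (s := univ) (c := z) univ_mem).2 hp.differentiableOn
        exact (differentiableOn_univ.1 this) w
      have hdq : Differentiable ℂ (dslope q z) := fun w => by
        have := (Complex.differentiableOn_dslope (s := univ) (c := z) univ_mem).2 hq.differentiableOn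
        exact (differentiableOn_univ.1 this) w
      have hne : dslope q z z ≠ 0 := by rw [dslope_same]; exact hd z hz
      have hev : ∀ᶠ w in 𝓝 z, dslope q z w ≠ 0 := hdq.continuous.continuousAt.eventually_ne hne
      refine ((hdp z).div (hdq z) hne).congr_of_eventuallyEq (hev.mono fun w hw => ?_)
      rcases eq_or_ne w z with rfl | hwz
      · simp [hz, dslope_same]
      · have hs := sub_ne_zero.2 hwz
        have e1 : q w = (w - z) * dslope q z w := by
          rw [dslope_of_ne _ hwz, ← smul_eq_mul, sub_smul_slope, vsub_eq_sub, hz, sub_zero]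
        have e2 : p w = (w - z) * dslope p z w := by
          rw [dslope_of_ne _ hwz, ← smul_eq_mul, sub_smul_slope, vsub_eq_sub, h0 z hz, sub_zero]
        have hqw : q w ≠ 0 := by rw [e1]; exact mul_ne_zero hs hw
        simp only [if_neg hqw, Pi.div_apply]
        rw [e1, e2, mul_div_mul_left _ _ hs]
    · have hev : ∀ᶠ w in 𝓝 z, q w ≠ 0 := hq.continuous.continuousAt.eventually_ne hz
      refine ((hp z).div (hq z) hz).congr_of_eventuallyEq (hev.mono fun w hw => ?_)
      simp [hw]
  · by_cases hz : q z = 0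
    · simp [hz, h0 z hz]
    · simp only [if_neg hz]
      field_simp

/-- The range of `A_θ - z` is everything, for nonreal `z`. -/
theorem exists_resolvent (θ : ℝ) {z : ℂ} (hz : z.im ≠ 0) (f : HF) :
    ∃ u, (u, f + z • u) ∈ graphA θ := by
  obtain ⟨p, hp, hr⟩ := exists_mem_sub_smul_orthogonal (isClosed_graphA θ)
    (fun p hp => inner_eq_of_mem_graphA hp hp) hz f
  set r := f - (p.2 - z • p.1) with hrdef
  -- A vector orthogonal to the range is an eigenvector of `A_θ` at the nonreal point `conj z`,
  -- hence zero.
  have hrmem : (r, conj z • r) ∈ graphA θ := by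
    rw [← adjoint_graphA, Submodule.mem_adjoint_iff]
    intro a b hab
    have := hr (a, b) hab
    simp only [inner_sub_left, inner_smul_left] at this
    simp only [inner_smul_right]
    exact this
  have hr0 : r = 0 := by
    have := abs_im_mul_norm_le (inner_eq_of_mem_graphA hrmem hrmem) (conj z)
    simp only [sub_self, norm_zero, Complex.conj_im, abs_neg] at this
    have h0 := abs_pos.2 hz
    have hn := norm_nonneg r
    exact norm_eq_zero.1 (by nlinarith)
  refine ⟨p.1, ?_⟩
  have : f + z • p.1 = p.2 := by
    have : p.2 = f + z • p.1 - r := by rw [hrdef]; abel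
    rw [this, hr0, sub_zero]
  rw [this]
  exact hp

/-- The eigenfunctions of `A_θ` are complete. -/
theorem eq_zero_of_inner_expVec_eq_zero {θ : ℝ} {f : HF}
    (hf : ∀ l : ℝ, secular θ l = 0 → inner ℂ (expVec l) f = 0) : f = 0 := by
  obtain ⟨r, hr, hmul⟩ := exists_differentiable_mul_eq (differentiable_numer θ f).fun_neg
    (differentiable_secular θ) (fun z hz => by
      obtain ⟨l, rfl⟩ : ∃ l : ℝ, z = l :=
        ⟨z.re, Complex.ext (by simp) (by simp [im_eq_zero_of_secular_eq_zero hz])⟩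
      rw [numer_eq_zero hz (hf l hz), neg_zero]) fun z hz => deriv_secular_ne_zero hz
  obtain ⟨u, hu⟩ := exists_resolvent θ (z := Complex.I) (by simp) f
  -- Off the real axis `r z` is the initial value of the resolvent solution, so the right side is
  -- its entire continuation in `z`.
  have hval : ∀ (x : unitInterval) (z : ℂ), z.im ≠ 0 → ∀ u, (u, f + z • u) ∈ graphA θ →
      u x = Complex.exp (Complex.I * z * x) * (r z + Complex.I *
        ∫ t in (0 : ℝ)..x, Complex.exp (-(Complex.I * z * t)) * evalR f t) := by
    intro x z hz u hu
    rw [apply_eq_of_mem_primRel (graphA_le_primRel θ hu) x]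
    have hne : secular θ z ≠ 0 := fun h => hz (im_eq_zero_of_secular_eq_zero h)
    rw [mul_left_cancel₀ hne ((secular_mul_apply_zero hu).trans (hmul z).symm)]
  have hu0 : u = 0 := by
    refine RKHS.ext fun x => ?_
    rw [hval x _ (by simp) u hu]
    have hdiff := differentiable_integral_exp_mul f x
    rw [RKHS.coe_zero, Pi.zero_apply]
    refine eq_zero_of_norm_mul_abs_im_le (C := ‖f‖) (G := fun z => Complex.exp (Complex.I * z * x) *
      (r z + Complex.I * ∫ t in (0 : ℝ)..x, Complex.exp (-(Complex.I * z * t)) * evalR f t))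
      (by fun_prop) (fun z hz => ?_) Complex.I
    obtain ⟨v, hv⟩ := exists_resolvent θ hz f
    rw [← hval x z hz v hv]
    have h1 := abs_im_mul_norm_le (inner_eq_of_mem_graphA hv hv) z
    simp only [add_sub_cancel_right] at h1
    have h2 := norm_evalR_le v x
    rw [evalR_coe] at h2
    calc ‖v x‖ * |z.im| ≤ ‖v‖ * |z.im| := by gcongr
      _ ≤ ‖f‖ := by rw [mul_comm]; exact h1
  rw [hu0, smul_zero, add_zero] at hu
  exact primRel_functional _ (graphA_le_primRel θ hu) rfl

/-! ### Diagonal operators in a Hilbert basis -/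

section HilbertBasis

variable {ι H : Type*} [NormedAddCommGroup H] [InnerProductSpace ℂ H]

theorem hasSum_norm_inner_sq (b : HilbertBasis ι ℂ H) (x : H) :
    HasSum (fun i => ‖inner ℂ (b i) x‖ ^ 2) (‖x‖ ^ 2) := by
  have h := b.hasSum_inner_mul_inner x x
  rw [inner_self_eq_norm_sq_to_K] at h
  have h2 := Complex.hasSum_re h
  convert h2 using 1
  · ext i
    rw [← inner_conj_symm x (b i), Complex.conj_mul']
    norm_cast
  · norm_cast

theorem ext_inner_basis (b : HilbertBasis ι ℂ H) {x y : H}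
    (h : ∀ i, inner ℂ (b i) x = inner ℂ (b i) y) : x = y := by
  refine b.repr.injective (lp.ext (funext fun i => ?_))
  rw [b.repr_apply_apply, b.repr_apply_apply, h]

/-- Bounded diagonal operators. -/
theorem exists_inner_eq_mul (b : HilbertBasis ι ℂ H) {m : ι → ℂ} {C : ℝ} (hm : ∀ i, ‖m i‖ ≤ C)
    (g : H) : ∃ f : H, ∀ i, inner ℂ (b i) f = m i * inner ℂ (b i) g := by
  have hmem : Memℓp (fun i => m i * inner ℂ (b i) g) 2 := by
    refine memℓp_gen ?_
    have hs := (hasSum_norm_inner_sq b g).summable.mul_left (C ^ 2)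
    refine hs.of_nonneg_of_le (fun i => by positivity) fun i => ?_
    have h2 : (2 : ENNReal).toReal = (2 : ℕ) := by simp
    rw [h2, Real.rpow_natCast, norm_mul, mul_pow]
    gcongr
    exact hm i
  refine ⟨b.repr.symm ⟨_, hmem⟩, fun i => ?_⟩
  rw [← b.repr_apply_apply, LinearIsometryEquiv.apply_symm_apply]

variable [CompleteSpace H]

/-- The diagonal unitary group with prescribed frequencies. -/
theorem exists_unitaryRep (b : HilbertBasis ι ℂ H) (l : ι → ℝ) :
    ∃ U : ℝ → H ≃ₗᵢ[ℂ] H, IsUnitaryRep U ∧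
      ∀ t ξ i, inner ℂ (b i) (U t ξ) = Complex.exp (Complex.I * l i * t) * inner ℂ (b i) ξ := by
  classical
  have horth : ∀ t : ℝ, Orthonormal ℂ fun i => Complex.exp (Complex.I * l i * t) • b i := by
    intro t
    have hb := orthonormal_iff_ite.1 b.orthonormal
    rw [orthonormal_iff_ite]
    intro i j
    rw [inner_smul_left, inner_smul_right, hb]
    split_ifs with hij
    · subst hij
      rw [conj_exp_I_mul_mul, mul_one, ← Complex.exp_add, neg_add_cancel, Complex.exp_zero]
    · simp
  have hbot : ∀ t : ℝ,
      (Submodule.span ℂ (range fun i => Complex.exp (Complex.I * l i * t) • b i))ᗮ = ⊥ := by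
    intro t
    rw [Submodule.eq_bot_iff]
    intro x hx
    refine ext_inner_basis b fun i => ?_
    have := hx _ (Submodule.subset_span ⟨i, rfl⟩)
    simp only [inner_smul_left] at this
    rw [inner_zero_right]
    exact (mul_eq_zero.1 this).resolve_left ((map_ne_zero _).2 (Complex.exp_ne_zero _))
  let c : ℝ → HilbertBasis ι ℂ H := fun t => HilbertBasis.mkOfOrthogonalEqBot (horth t) (hbot t)
  have hc : ∀ t i, c t i = Complex.exp (Complex.I * l i * t) • b i := fun t i => by
    simp only [c, HilbertBasis.coe_mkOfOrthogonalEqBot]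
  let U : ℝ → H ≃ₗᵢ[ℂ] H := fun t => b.repr.trans (c t).repr.symm
  have hU : ∀ t ξ i, inner ℂ (b i) (U t ξ)
      = Complex.exp (Complex.I * l i * t) * inner ℂ (b i) ξ := by
    intro t ξ i
    have h1 : (c t).repr (U t ξ) i = b.repr ξ i := by simp [U]
    rw [(c t).repr_apply_apply, b.repr_apply_apply, hc, inner_smul_left, conj_exp_I_mul_mul] at h1
    rw [← h1, ← mul_assoc, ← Complex.exp_add, add_neg_cancel, Complex.exp_zero, one_mul]
  refine ⟨U, ⟨fun s t ξ => ext_inner_basis b fun i => ?_, fun ξ => ?_⟩, hU⟩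
  · rw [hU, hU, hU, ← mul_assoc, ← Complex.exp_add]
    congr 2
    push_cast; ring
  -- Strong continuity is clear on basis vectors, passes to their span, and reaches the closure
  -- because each `U t` is an isometry and the approximation is therefore uniform in `t`.
  · let S : Submodule ℂ H :=
      { carrier := {ξ | Continuous fun t => U t ξ}
        zero_mem' := by simpa using continuous_const
        add_mem' := fun {x y} hx hy => by
          change Continuous fun t => U t (x + y)
          simp only [map_add]
          exact Continuous.add hx hy
        smul_mem' := fun a x hx => by
          change Continuous fun t => U t (a • x)
          simp only [map_smul]
          exact Continuous.const_smul hx a }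
    have hbS : Submodule.span ℂ (range b) ≤ S := by
      refine Submodule.span_le.2 ?_
      rintro _ ⟨i, rfl⟩
      have hUb : ∀ t, U t (b i) = Complex.exp (Complex.I * l i * t) • b i := fun t =>
        ext_inner_basis b fun j => by
          rw [hU, inner_smul_right, orthonormal_iff_ite.1 b.orthonormal]
          split_ifs with hij
          · rw [hij]
          · simp
      change Continuous fun t => U t (b i)
      simp only [hUb]
      fun_prop
    have hξ : ξ ∈ closure (S : Set H) := by
      have : ξ ∈ (Submodule.span ℂ (range b)).topologicalClosure := by
        rw [b.dense_span]; trivial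
      exact closure_mono hbS this
    refine continuous_of_uniform_approx_of_continuous fun u hu => ?_
    obtain ⟨ε, hε, hεu⟩ := Metric.mem_uniformity_dist.1 hu
    obtain ⟨η, hη, hd⟩ := Metric.mem_closure_iff.1 hξ ε hε
    exact ⟨fun t => U t η, hη, fun t => hεu (by rwa [(U t).dist_map])⟩

end HilbertBasis

/-! ### The eigenbasis and the spectrum of `A_θ` -/

section Eigenbasis

variable {θ : ℝ} {S : Set ℝ} (hS : ∀ l, l ∈ S ↔ secular θ l = 0)

theorem ofReal_sqrt_mul_self (l : ℝ) :
    (√(2 / (l ^ 2 + 3)) : ℂ) * (√(2 / (l ^ 2 + 3)) : ℂ) = ((2 / (l ^ 2 + 3) : ℝ) : ℂ) := by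
  rw [← Complex.ofReal_mul, Real.mul_self_sqrt (by positivity)]

include hS in
theorem orthonormal_expVec :
    Orthonormal ℂ fun l : S => (√(2 / ((l : ℝ) ^ 2 + 3)) : ℂ) • expVec l := by
  classical
  rw [orthonormal_iff_ite]
  intro l m
  rw [inner_smul_left, inner_smul_right, Complex.conj_ofReal]
  split_ifs with h
  · subst h
    have h3 : ((l : ℝ) : ℂ) ^ 2 + 3 ≠ 0 := by
      have : (l : ℝ) ^ 2 + 3 ≠ 0 := by positivity
      exact_mod_cast this
    rw [← mul_assoc, ofReal_sqrt_mul_self, inner_expVec_self]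
    push_cast
    field_simp
  · rw [inner_expVec_of_ne ((hS l).1 l.2) ((hS m).1 m.2) fun e => h (Subtype.ext e)]
    simp

theorem sqrt_weight_ne_zero (l : ℝ) : (√(2 / (l ^ 2 + 3)) : ℂ) ≠ 0 :=
  Complex.ofReal_ne_zero.2 (by positivity)

/-- The orthonormal basis of eigenfunctions of `A_θ`. -/
def eigenbasis : HilbertBasis S ℂ HF :=
  HilbertBasis.mkOfOrthogonalEqBot (orthonormal_expVec hS) (by
    rw [Submodule.eq_bot_iff]
    intro f hf
    refine eq_zero_of_inner_expVec_eq_zero (θ := θ) fun l hl => ?_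
    have := hf _ (Submodule.subset_span ⟨⟨l, (hS l).2 hl⟩, rfl⟩)
    simp only [inner_smul_left, Complex.conj_ofReal] at this
    exact (mul_eq_zero.1 this).resolve_left (sqrt_weight_ne_zero l))

theorem eigenbasis_apply (l : S) :
    eigenbasis hS l = (√(2 / ((l : ℝ) ^ 2 + 3)) : ℂ) • expVec l := by
  rw [eigenbasis, HilbertBasis.coe_mkOfOrthogonalEqBot]

theorem inner_eigenbasis_kvec (l : S) (x : unitInterval) : inner ℂ (eigenbasis hS l) (kvec x)
    = (√(2 / ((l : ℝ) ^ 2 + 3)) : ℂ) * Complex.exp (-(Complex.I * (l : ℝ) * x)) := by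
  rw [eigenbasis_apply, inner_smul_left, Complex.conj_ofReal, ← inner_conj_symm, inner_kvec,
    expVec_apply, conj_exp_I_mul_mul]

theorem eigenbasis_mem_graphA (l : S) :
    (eigenbasis hS l, ((l : ℝ) : ℂ) • eigenbasis hS l) ∈ graphA θ := by
  have := (graphA θ).smul_mem (√(2 / ((l : ℝ) ^ 2 + 3)) : ℂ)
    (expVec_mem_graphA_iff.2 ((hS l).1 l.2))
  rw [eigenbasis_apply, smul_comm]
  exact this

theorem inner_eigenbasis_of_mem_graphA {p : HF × HF} (hp : p ∈ graphA θ) (l : S) :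
    inner ℂ (eigenbasis hS l) p.2 = (l : ℝ) * inner ℂ (eigenbasis hS l) p.1 := by
  rw [← inner_eq_of_mem_graphA (eigenbasis_mem_graphA hS l) hp, inner_smul_left,
    Complex.conj_ofReal]

/-- By selfadjointness it suffices to test against `graphA θ`, where Parseval reduces the claim to
coefficients. So `A_θ` is the diagonal operator with maximal domain. -/
theorem mem_graphA_of_inner_eigenbasis {p : HF × HF} (h : ∀ l : S,
    inner ℂ (eigenbasis hS l) p.2 = (l : ℝ) * inner ℂ (eigenbasis hS l) p.1) : p ∈ graphA θ := by
  rw [← adjoint_graphA, Submodule.mem_adjoint_iff]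
  intro a b hab
  rw [sub_eq_zero, ← (eigenbasis hS).tsum_inner_mul_inner, ← (eigenbasis hS).tsum_inner_mul_inner]
  refine tsum_congr fun l => ?_
  rw [h, ← inner_conj_symm b, inner_eigenbasis_of_mem_graphA hS hab, map_mul, Complex.conj_ofReal,
    inner_conj_symm]
  ring

-- The zero set of `secular θ` is closed by continuity alone; discreteness is not needed for this
-- gap.
include hS in
theorem exists_le_norm_sub {z : ℂ} (hz : z ∉ (fun l : ℝ => (l : ℂ)) '' S) :
    ∃ d > 0, ∀ l : S, d ≤ ‖((l : ℝ) : ℂ) - z‖ := by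
  have hcl : IsClosed S := by
    have : S = (fun l : ℝ => secular θ l) ⁻¹' {0} := by ext l; simp [hS]
    rw [this]
    exact isClosed_singleton.preimage
      ((differentiable_secular θ).continuous.comp Complex.continuous_ofReal)
  have hcl' : IsClosed ((fun l : ℝ => (l : ℂ)) '' S) :=
    Complex.isometry_ofReal.isClosedEmbedding.isClosedMap _ hcl
  obtain ⟨d, hd, hball⟩ := Metric.isOpen_iff.1 hcl'.isOpen_compl z hz
  refine ⟨d, hd, fun l => ?_⟩
  by_contra hlt
  exact hball (mem_ball_iff_norm.2 (not_le.1 hlt)) ⟨l, l.2, rfl⟩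

include hS in
theorem mul_norm_fst_le {z : ℂ} {d : ℝ} (hd : 0 < d) (hdl : ∀ l : S, d ≤ ‖((l : ℝ) : ℂ) - z‖)
    {p : HF × HF} (hp : p ∈ graphA θ) : d * ‖p.1‖ ≤ ‖p.2 - z • p.1‖ := by
  have h1 := (hasSum_norm_inner_sq (eigenbasis hS) p.1).mul_left (d ^ 2)
  have h2 := hasSum_norm_inner_sq (eigenbasis hS) (p.2 - z • p.1)
  have h3 : d ^ 2 * ‖p.1‖ ^ 2 ≤ ‖p.2 - z • p.1‖ ^ 2 := by
    refine hasSum_le (fun l => ?_) h1 h2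
    rw [inner_sub_right, inner_smul_right, inner_eigenbasis_of_mem_graphA hS hp, ← sub_mul,
      norm_mul, mul_pow]
    gcongr
    exact hdl l
  rw [← mul_pow] at h3
  exact (pow_le_pow_iff_left₀ (by positivity) (norm_nonneg _) two_ne_zero).1 h3

include hS in
/-- The spectrum of `A_θ` consists of the zeros of the secular function. -/
theorem spectrumOp_opA : spectrumOp (opA θ) = (fun l : ℝ => (l : ℂ)) '' S := by
  have hgr : ∀ f : (opA θ).domain, ((f : HF), opA θ f) ∈ graphA θ := fun f =>
    opA_graph θ ▸ LinearPMap.mem_graph _ f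
  ext z
  constructor
  · intro hz
    by_contra hzS
    obtain ⟨d, hd, hdl⟩ := exists_le_norm_sub hS hzS
    refine hz ⟨⟨fun f g hfg => ?_, fun g => ?_⟩, d⁻¹, fun f => ?_⟩
    · have h1 := mul_norm_fst_le hS hd hdl ((graphA θ).sub_mem (hgr f) (hgr g))
      have h2 : (opA θ f - opA θ g) - z • ((f : HF) - g) = 0 := by
        have h3 : opA θ f - z • (f : HF) = opA θ g - z • (g : HF) := hfg
        rw [smul_sub, sub_sub_sub_comm, h3, sub_self]
      simp only [Prod.fst_sub, Prod.snd_sub, h2, norm_zero] at h1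
      have h3 : ‖(f : HF) - g‖ = 0 := by
        have := norm_nonneg ((f : HF) - g)
        nlinarith
      exact Subtype.ext (sub_eq_zero.1 (norm_eq_zero.1 h3))
    · obtain ⟨u, hu⟩ := exists_inner_eq_mul (eigenbasis hS)
        (m := fun l : S => (((l : ℝ) : ℂ) - z)⁻¹) (C := d⁻¹)
        (fun l => by rw [norm_inv]; exact inv_anti₀ hd (hdl l)) g
      have hmem : (u, g + z • u) ∈ graphA θ := by
        refine mem_graphA_of_inner_eigenbasis hS fun l => ?_
        have hne : ((l : ℝ) : ℂ) - z ≠ 0 := norm_pos_iff.1 (hd.trans_le (hdl l))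
        rw [inner_add_right, inner_smul_right, hu]
        field_simp
        ring
      rw [← opA_graph] at hmem
      obtain ⟨v, hv1, hv2⟩ := (LinearPMap.mem_graph_iff _).1 hmem
      refine ⟨v, ?_⟩
      simp only at hv1 hv2 ⊢
      rw [hv1, hv2, add_sub_cancel_right]
    · rw [inv_mul_eq_div, le_div_iff₀' hd]
      exact mul_norm_fst_le hS hd hdl (hgr f)
  · rintro ⟨l, hl, rfl⟩ ⟨⟨hinj, -⟩, -⟩
    have hmem := expVec_mem_graphA_iff.2 ((hS l).1 hl)
    rw [← opA_graph] at hmem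
    obtain ⟨v, hv1, hv2⟩ := (LinearPMap.mem_graph_iff _).1 hmem
    have h0 : v = 0 := hinj (by
      simp only at hv1 hv2 ⊢
      rw [hv1, hv2, sub_self, LinearPMap.map_zero, ZeroMemClass.coe_zero, smul_zero, sub_zero])
    rw [h0] at hv1
    exact expVec_ne_zero l hv1.symm

end Eigenbasis

/-! ### The extension and its spectral measure -/

/-- The eigenbasis is first indexed by the zero set itself, which determines the spectrum; from here
on it can be indexed by `Lam θ`. -/
theorem mem_Lam (θ l : ℝ) : l ∈ Lam θ ↔ secular θ l = 0 := by
  have : (l : ℂ) ∈ spectrumOp (opA θ) ↔ secular θ l = 0 := by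
    rw [spectrumOp_opA (S := {l : ℝ | secular θ l = 0}) fun _ => Iff.rfl]
    simp
  exact this

theorem spectrumOp_eq_image_Lam (θ : ℝ) :
    spectrumOp (opA θ) = (fun l : ℝ => (l : ℂ)) '' Lam θ :=
  spectrumOp_opA (mem_Lam θ)

/-- Parseval for the unit vector `F_0`, whose coefficients are the square roots of the weights. -/
theorem hasSum_weight (θ : ℝ) : HasSum (fun l : Lam θ => 2 / ((l : ℝ) ^ 2 + 3)) 1 := by
  have h := hasSum_norm_inner_sq (eigenbasis (mem_Lam θ)) (kvec 0)
  rw [norm_kvec, one_pow] at h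
  convert h using 2 with l
  rw [inner_eigenbasis_kvec, Icc.coe_zero, Complex.ofReal_zero, mul_zero, neg_zero,
    Complex.exp_zero, mul_one, Complex.norm_real, Real.norm_eq_abs, sq_abs,
    Real.sq_sqrt (by positivity)]

/-- Weights in a bounded interval are bounded below, and a summable family has only finitely many
such terms. -/
theorem finite_Lam_inter_Icc (θ R : ℝ) : (Lam θ ∩ Icc (-R) R).Finite := by
  have h := (hasSum_weight θ).summable.tendsto_cofinite_zero
  have hpos : 0 < 2 / (R ^ 2 + 3) := by positivity
  have hfin : {l : Lam θ | ¬ 2 / ((l : ℝ) ^ 2 + 3) < 2 / (R ^ 2 + 3)}.Finite :=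
    h.eventually_lt_const hpos
  refine (hfin.image Subtype.val).subset ?_
  rintro l ⟨hl, hlR⟩
  refine ⟨⟨l, hl⟩, ?_, rfl⟩
  have : l ^ 2 ≤ R ^ 2 := sq_le_sq' hlR.1 hlR.2
  simp only [mem_ofPred_eq, not_lt]
  gcongr

theorem exists_dilation (θ : ℝ) : ∃ U : ℝ → HF ≃ₗᵢ[ℂ] HF, IsUnitaryRep U ∧
    (∀ x : unitInterval, U (-(x : ℝ)) (kvec 0) = kvec x) ∧
    ∀ t : ℝ, Fext θ t = inner ℂ (kvec 0) (U t (kvec 0)) := by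
  obtain ⟨U, hrep, hU⟩ := exists_unitaryRep (eigenbasis (mem_Lam θ)) (fun l => (l : ℝ))
  refine ⟨U, hrep, fun x => ?_, fun t => ?_⟩
  · refine ext_inner_basis (eigenbasis (mem_Lam θ)) fun l => ?_
    rw [hU, inner_eigenbasis_kvec, inner_eigenbasis_kvec]
    simp [mul_comm]
  · rw [← (eigenbasis (mem_Lam θ)).tsum_inner_mul_inner, Fext]
    refine tsum_congr fun l => ?_
    rw [hU, ← inner_conj_symm, inner_eigenbasis_kvec, ← ofReal_sqrt_mul_self]
    simp
    ring

theorem isUnitaryRep_zero {H : Type*} [NormedAddCommGroup H] [InnerProductSpace ℂ H]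
    {U : ℝ → H ≃ₗᵢ[ℂ] H} (hU : IsUnitaryRep U) (ξ : H) : U 0 ξ = ξ := by
  have := hU.1 0 0 ξ
  rw [add_zero] at this
  exact ((U 0).injective this).symm

theorem inner_unitaryRep_sub {H : Type*} [NormedAddCommGroup H] [InnerProductSpace ℂ H]
    {U : ℝ → H ≃ₗᵢ[ℂ] H} (hU : IsUnitaryRep U) (s t : ℝ) (ξ : H) :
    inner ℂ ξ (U (s - t) ξ) = inner ℂ (U (-s) ξ) (U (-t) ξ) := by
  rw [← (U s).inner_map_map (U (-s) ξ), ← hU.1, ← hU.1, add_neg_cancel, isUnitaryRep_zero hU,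
    sub_eq_add_neg]

theorem continuous_Fext (θ : ℝ) : Continuous (Fext θ) := by
  obtain ⟨U, hrep, -, hF⟩ := exists_dilation θ
  rw [funext hF]
  exact continuous_const.inner (hrep.2 _)

theorem isPosDefFun_Fext (θ : ℝ) : IsPosDefFun (Fext θ) := by
  obtain ⟨U, hrep, -, hF⟩ := exists_dilation θ
  intro n c x
  have h : ∑ i, ∑ j, conj (c i) * c j * Fext θ (x i - x j)
      = inner ℂ (∑ i, c i • U (-x i) (kvec 0)) (∑ i, c i • U (-x i) (kvec 0)) := by
    rw [sum_inner]
    refine Finset.sum_congr rfl fun i _ => ?_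
    rw [inner_sum]
    refine Finset.sum_congr rfl fun j _ => ?_
    rw [hF, inner_unitaryRep_sub hrep, inner_smul_left, inner_smul_right, mul_assoc]
  rw [h]
  rw [inner_self_eq_norm_sq_to_K, ← RCLike.ofReal_pow]
  exact Complex.zero_le_real.2 (sq_nonneg _)

theorem Fext_eq_F (θ : ℝ) {x : ℝ} (hx : x ∈ Ioo (-1 : ℝ) 1) : Fext θ x = F x := by
  obtain ⟨U, hrep, hk, hF⟩ := exists_dilation θ
  rw [hF]
  rcases le_total 0 x with h0 | h0
  -- Only `U(-x)` with `x ≥ 0` is known on `F_0`, so for positive `x` the unitary is moved to the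
  -- left argument.
  · have h1 := inner_unitaryRep_sub hrep x 0 (kvec 0)
    rw [sub_zero, neg_zero, isUnitaryRep_zero hrep] at h1
    rw [h1, hk ⟨x, h0, hx.2.le⟩, inner_kvec, kvec_apply]
    simp [F]
  · have h2 := hk ⟨-x, by linarith, by linarith [hx.1]⟩
    rw [neg_neg] at h2
    rw [h2, inner_kvec, kvec_apply]
    simp [F]

theorem isProbabilityMeasure_muExt (θ : ℝ) : IsProbabilityMeasure (muExt θ) := by
  refine ⟨?_⟩
  have h := hasSum_weight θ
  rw [muExt, Measure.sum_apply _ MeasurableSet.univ]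
  simp only [Measure.smul_apply, measure_univ, smul_eq_mul, mul_one]
  rw [← ENNReal.ofReal_tsum_of_nonneg (fun l => by positivity) h.summable, h.tsum_eq,
    ENNReal.ofReal_one]

theorem Fext_eq_integral (θ x : ℝ) :
    Fext θ x = ∫ l : ℝ, Complex.exp (Complex.I * l * x) ∂(muExt θ) := by
  have := isProbabilityMeasure_muExt θ
  have hint : Integrable (fun l : ℝ => Complex.exp (Complex.I * l * x)) (muExt θ) := by
    refine Integrable.of_bound (Continuous.aestronglyMeasurable (by fun_prop)) 1
      (Eventually.of_forall fun l => ?_)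
    rw [Complex.norm_exp]
    simp
  rw [muExt] at hint ⊢
  rw [integral_sum_measure hint, Fext]
  refine tsum_congr fun l => ?_
  rw [integral_smul_measure, integral_dirac, ENNReal.toReal_ofReal (by positivity),
    Complex.real_smul]

theorem eq_muExt {θ : ℝ} {ν : Measure ℝ} [IsFiniteMeasure ν]
    (h : ∀ x : ℝ, Fext θ x = ∫ l : ℝ, Complex.exp (Complex.I * l * x) ∂ν) : ν = muExt θ := by
  have := isProbabilityMeasure_muExt θ
  refine Measure.ext_of_charFun (funext fun t => ?_)
  have he : ∀ l : ℝ, Complex.exp (t * l * Complex.I) = Complex.exp (Complex.I * l * t) :=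
    fun l => by congr 1; ring
  simp only [charFun_apply_real, he]
  rw [← h, Fext_eq_integral]

end ExpExt

end

theorem mainTheorem2 (θ : ℝ) :
    -- `A_θ` is a selfadjoint extension of `-i D_F`
    (ExpExt.opS ≤ ExpExt.opA θ ∧ IsSelfAdjoint (ExpExt.opA θ)) ∧
    -- its spectrum is a discrete set of real numbers
    (ExpExt.spectrumOp (ExpExt.opA θ) = (fun l : ℝ => (l : ℂ)) '' ExpExt.Lam θ ∧
      ∀ R : ℝ, (ExpExt.Lam θ ∩ Set.Icc (-R) R).Finite) ∧
    -- the series defining the extension converges absolutely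
    Summable (fun l : ExpExt.Lam θ => 2 / ((l : ℝ) ^ 2 + 3)) ∧
    -- it is a continuous positive definite extension of `F`
    (Continuous (ExpExt.Fext θ) ∧ ExpExt.IsPosDefFun (ExpExt.Fext θ) ∧
      ∀ x ∈ Set.Ioo (-1 : ℝ) 1, ExpExt.Fext θ x = ExpExt.F x) ∧
    -- of type 1
    ExpExt.IsTypeOne (ExpExt.Fext θ) ∧
    -- whose spectral measure is `μ_θ`
    (MeasureTheory.IsProbabilityMeasure (ExpExt.muExt θ) ∧
      (∀ x : ℝ, ExpExt.Fext θ x =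
        ∫ l : ℝ, Complex.exp (Complex.I * l * x) ∂(ExpExt.muExt θ)) ∧
      ∀ ν : MeasureTheory.Measure ℝ, MeasureTheory.IsFiniteMeasure ν →
        (∀ x : ℝ, ExpExt.Fext θ x = ∫ l : ℝ, Complex.exp (Complex.I * l * x) ∂ν) →
        ν = ExpExt.muExt θ) := by
  exact ⟨⟨ExpExt.opS_le_opA θ, ExpExt.isSelfAdjoint_opA θ⟩,
    ⟨ExpExt.spectrumOp_eq_image_Lam θ, ExpExt.finite_Lam_inter_Icc θ⟩,
    (ExpExt.hasSum_weight θ).summable,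
    ⟨ExpExt.continuous_Fext θ, ExpExt.isPosDefFun_Fext θ, fun _ hx => ExpExt.Fext_eq_F θ hx⟩,
    ExpExt.exists_dilation θ,
    ExpExt.isProbabilityMeasure_muExt θ, ExpExt.Fext_eq_integral θ,
    fun _ _ h => ExpExt.eq_muExt h⟩
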